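/- A conjunctive query without self-joins $Q(\mathbf A) :- R_1(\mathbb A_1),\dots,R_p(\mathbb A_p)$ ($p\ge 1$) has pairwise distinct relation symbols $R_1,\dots,R_p$ on finite attribute sets $\mathbb A_1,\dots,\mathbb A_p$ and output attributes $\mathbf A\subseteq\mathbb A:=\bigcup_i\mathbb A_i$; it is full if $\mathbf A=\mathbb A$. An instance $D$ consists of a finite set of tuples on $\mathbb A_i$ for each $i$, with values in $\mathbb N$; $|D|$ is the total number of its tuples. The result $Q(D)$ is the projection on $\mathbf A$ (without duplicates) of the natural join of the relations, i.e. of the set of tuples on $\mathbb A$ whose restriction to $\mathbb A_i$ belongs to $R_i^D$ for every $i$. For an integer $1\le k\le|Q(D)|$, the problem $\mathrm{ADP}(Q,D,k)$ (aggregated deletion propagation) asks for a set $S\subseteq D$ of input tuples of minimum size $|S|$ such that $|Q(D)\setminus Q(D\setminus S)|\ge k$; any such $S$, of minimum size or not, is called feasible. For a fixed query $Q$ and a function $\alpha$ of $k$, a polynomial-time $\alpha$-approximation algorithm for $\mathrm{ADP}(Q,\cdot,\cdot)$ is a program of a random access machine (with addition and truncated subtraction of natural numbers as arithmetic operations, and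 unit costs) for which there is a polynomial $T$ such that, given any instance $D$ (its tuples listed in any order) and any integer $k$ with $1\le k\le|Q(D)|$, the program outputs within $T(|D|)$ steps a feasible set $S$ with $|S|\le\alpha(k)\cdot|S'|$ for every feasible $S'$. Theorem. (1) There is an absolute constant $C$ such that for every full conjunctive query $Q$ without self-joins there is a polynomial-time $C(1+\log k)$-approximation algorithm for $\mathrm{ADP}(Q,\cdot,\cdot)$. (2) For every full conjunctive query $Q$ without self-joins, with $p$ relations, there is a polynomial-time $p$-approximation algorithm for $\mathrm{ADP}(Q,\cdot,\cdot)$. -/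

import Mathlib

/-! ### Random access machine programs

Programs of a unit-cost random access machine, in structured form.  The memory consists of
registers and of arrays, all holding natural numbers; a program mentions only finitely many registers
and arrays.  The arithmetic is addition and truncated subtraction, so that the length of the binary
representation of a number grows by at most one bit in each step, and step counts agree with those
of a Turing machine up to a polynomial. -/

namespace RAM

/-- The memory: registers `reg x` and array cells `arr a i`. -/
structure State where
  reg : ℕ → ℕ
  arr : ℕ → ℕ → ℕ

/-- Arithmetic expressions: constants, registers, array cells (with a computed index), sums and
truncated differences. -/
inductive Exp where
  | const (n : ℕ)
  | reg (x : ℕ)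
  | arr (a : ℕ) (i : Exp)
  | add (e f : Exp)
  | sub (e f : Exp)

/-- The value of an expression. -/
def Exp.eval (s : State) : Exp → ℕ
  | .const n => n
  | .reg x => s.reg x
  | .arr a i => s.arr a (i.eval s)
  | .add e f => e.eval s + f.eval s
  | .sub e f => e.eval s - f.eval s

/-- The number of steps that the evaluation of an expression takes: one for each constant, memory
access and arithmetic operation. -/
def Exp.cost : Exp → ℕ
  | .const _ => 1
  | .reg _ => 1
  | .arr _ i => i.cost + 1
  | .add e f => e.cost + f.cost + 1
  | .sub e f => e.cost + f.cost + 1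

/-- Programs. -/
inductive Program where
  | skip
  /-- `reg x := e` -/
  | assign (x : ℕ) (e : Exp)
  /-- `arr a i := e` -/
  | store (a : ℕ) (i e : Exp)
  | seq (c d : Program)
  /-- execute `c` if the value of `e` is nonzero, and `d` otherwise -/
  | ite (e : Exp) (c d : Program)
  /-- execute `c` again and again, as long as the value of `e` is nonzero -/
  | whileDo (e : Exp) (c : Program)

/-- `Exec c s t s'`: started in the memory `s`, the program `c` terminates after exactly `t` steps
with the memory `s'`. -/
inductive Exec : Program → State → ℕ → State → Prop
  | skip (s : State) : Exec .skip s 1 s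
  | assign (x : ℕ) (e : Exp) (s : State) :
      Exec (.assign x e) s (e.cost + 1) { s with reg := Function.update s.reg x (e.eval s) }
  | store (a : ℕ) (i e : Exp) (s : State) :
      Exec (.store a i e) s (i.cost + e.cost + 1)
        { s with arr := Function.update s.arr a
                          (Function.update (s.arr a) (i.eval s) (e.eval s)) }
  | seq {c d : Program} {s s' s'' : State} {t t' : ℕ}
      (hc : Exec c s t s') (hd : Exec d s' t' s'') : Exec (.seq c d) s (t + t') s''
  | ite_true {e : Exp} {c d : Program} {s s' : State} {t : ℕ}
      (he : e.eval s ≠ 0) (hc : Exec c s t s') : Exec (.ite e c d) s (e.cost + 1 + t) s'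
  | ite_false {e : Exp} {c d : Program} {s s' : State} {t : ℕ}
      (he : e.eval s = 0) (hd : Exec d s t s') : Exec (.ite e c d) s (e.cost + 1 + t) s'
  | while_true {e : Exp} {c : Program} {s s' s'' : State} {t t' : ℕ}
      (he : e.eval s ≠ 0) (hc : Exec c s t s') (hw : Exec (.whileDo e c) s' t' s'') :
      Exec (.whileDo e c) s (e.cost + 1 + t + t') s''
  | while_false {e : Exp} {c : Program} {s : State}
      (he : e.eval s = 0) : Exec (.whileDo e c) s (e.cost + 1) s

/-- The initial memory on the input `xs`: the input stands in array `0`, its length in register `0`,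
and every other register and cell is `0`. -/
def State.init (xs : List ℕ) : State where
  reg x := if x = 0 then xs.length else 0
  arr a i := if a = 0 then xs.getD i 0 else 0

/-- The output that is read off a final memory: the first `reg 1` cells of array `1`. -/
def State.output (s : State) : List ℕ :=
  (List.range (s.reg 1)).map (s.arr 1)

/-- On the input `xs`, the program `c` halts after exactly `t` steps with the output `ys`. -/
def Program.Outputs (c : Program) (xs : List ℕ) (t : ℕ) (ys : List ℕ) : Prop :=
  ∃ s : State, Exec c (State.init xs) t s ∧ s.output = ys

end RAM

/-! ### Conjunctive queries and aggregated deletion propagation -/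

namespace ADP

/-- Attributes are named by natural numbers, and so are the values of the attributes. A tuple on the
set `B` of attributes assigns a value to each attribute in `B`. -/
abbrev Tuple (B : Finset ℕ) : Type := B → ℕ

/-- The projection of a tuple on a subset of its attributes. -/
def Tuple.restrict {B C : Finset ℕ} (h : B ⊆ C) (t : Tuple C) : Tuple B := fun a => t ⟨a, h a.2⟩

/-- A conjunctive query `Q(head) :- R_1(attrs 1), ..., R_p(attrs p)` without self-joins: the
`p ≥ 1` relations of the body are pairwise distinct relation symbols, identified with their
indices. Vacuum relations (`attrs i = ∅`) are allowed. -/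
structure CQ where
  /-- the number of relations -/
  p : ℕ
  p_pos : 0 < p
  /-- the attributes of each relation -/
  attrs : Fin p → Finset ℕ
  /-- the output attributes -/
  head : Finset ℕ
  head_subset : head ⊆ Finset.univ.biUnion attrs

namespace CQ

variable (Q : CQ)

/-- The set of all attributes that appear in the body of the query. -/
def attr : Finset ℕ := Finset.univ.biUnion Q.attrs

lemma attrs_subset (i : Fin Q.p) : Q.attrs i ⊆ Q.attr :=
  Finset.subset_biUnion_of_mem Q.attrs (Finset.mem_univ i)

/-- A full query: all attributes are output attributes. -/
def IsFull : Prop := Q.head = Q.attr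

/-- A database instance: a finite set of tuples for each relation. -/
abbrev Database : Type := (i : Fin Q.p) → Finset (Tuple (Q.attrs i))

variable {Q}

/-- The number of tuples of a database. -/
def Database.size (D : Q.Database) : ℕ := ∑ i, (D i).card

variable (Q)

/-- The natural join of the relations. -/
def join (D : Q.Database) : Set (Tuple Q.attr) :=
  {t | ∀ i, Tuple.restrict (Q.attrs_subset i) t ∈ D i}

/-- The query result `Q(D)`: the projection of the natural join on the output attributes, without
duplicates. -/
def result (D : Q.Database) : Set (Tuple Q.head) :=
  Tuple.restrict Q.head_subset '' Q.join D

lemma join_finite (D : Q.Database) : (Q.join D).Finite := by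
  refine Set.Finite.of_finite_image (f := fun (t : Tuple Q.attr) (i : Fin Q.p) =>
    Tuple.restrict (Q.attrs_subset i) t) ?_ ?_
  · refine (Set.Finite.pi' (fun i => (D i).finite_toSet)).subset ?_
    rintro _ ⟨t, ht, rfl⟩ i
    exact ht i
  · intro t _ t' _ h
    ext ⟨a, ha⟩
    obtain ⟨i, -, hi⟩ := Finset.mem_biUnion.1 ha
    exact congrFun (congrFun h i) ⟨a, hi⟩

lemma result_finite (D : Q.Database) : (Q.result D).Finite :=
  (Q.join_finite D).image _

/-- `Q.IsSolution D k S`: the set `S` of input tuples of `D` is a feasible solution of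
`ADP(Q, D, k)`, i.e. the removal of `S` from `D` removes at least `k` results from `Q(D)`. -/
def IsSolution (D : Q.Database) (k : ℕ) (S : Q.Database) : Prop :=
  (∀ i, S i ⊆ D i) ∧ k ≤ (Q.result D \ Q.result (fun i => D i \ S i)).ncard

/-- The values of a tuple, in the increasing order of the attributes. -/
def encodeTuple {B : Finset ℕ} (t : Tuple B) : List ℕ :=
  List.ofFn fun j => t (B.orderIsoOfFin rfl j)

/-- `L` lists the tuples of each relation of `D` without repetitions, in any order. -/
def IsListing (D : Q.Database) (L : (i : Fin Q.p) → List (Tuple (Q.attrs i))) : Prop :=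
  ∀ i, (L i).Nodup ∧ (L i).toFinset = D i

/-- A listed database as a sequence of numbers: for each relation in turn, the number of its tuples,
followed by the values of the tuples. -/
def encode (L : (i : Fin Q.p) → List (Tuple (Q.attrs i))) : List ℕ :=
  (List.finRange Q.p).flatMap fun i => (L i).length :: (L i).flatMap encodeTuple

/-- The program `c` is a polynomial-time (data complexity: the query is fixed) `α(k)`-approximation
algorithm for `ADP(Q, D, k)`: there is a polynomial `T` such that, for all instances `D` (in whichever
order its tuples are listed) and all integers `1 ≤ k ≤ |Q(D)|`, it outputs within `T(|D|)` steps a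
feasible solution that has at most `α(k)` times as many tuples as any feasible solution. -/
def IsPolyTimeApprox (c : RAM.Program) (α : ℕ → ℝ) : Prop :=
  ∃ T : Polynomial ℕ, ∀ (D : Q.Database) (L : (i : Fin Q.p) → List (Tuple (Q.attrs i))) (k : ℕ),
    Q.IsListing D L → 1 ≤ k → k ≤ (Q.result D).ncard →
      ∃ (S : Q.Database) (L' : (i : Fin Q.p) → List (Tuple (Q.attrs i))) (t : ℕ),
        Q.IsListing S L' ∧ c.Outputs (k :: Q.encode L) t (Q.encode L') ∧ t ≤ T.eval D.size ∧
        Q.IsSolution D k S ∧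
        ∀ S' : Q.Database, Q.IsSolution D k S' → (S.size : ℝ) ≤ α k * (S'.size : ℝ)

end CQ

end ADP

/-!
A full query without self-joins turns `ADP(Q, D, k)` into the problem of covering `k` elements by few
sets: the elements are the results, and each input tuple is the set of the results that it takes part
in. Each result comes from exactly one tuple of each relation, so it lies in exactly `p` sets.

*Logarithmic factor.* The greedy algorithm picks, again and again, a set with the largest number of
uncovered elements. If some solution has `m` sets, each step reduces the number of elements that are
still missing by a factor `1 - 1/m`, so at most `1 + m log k ≤ m (1 + log k)` sets are picked
(`Covering.Greedy.picks_le`); hence the constant `C = 1`.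

*Factor `p`.* The primal-dual algorithm raises the dual variables of all uncovered elements
simultaneously, and picks a set as soon as its dual constraint is tight. Since there is neither
multiplication nor division, the dual variables are scaled by a large number `N` and raised in unit
steps, which violates the constraints by at most the number of the elements. All sets but the last
one are paid for by the dual variables of covered elements, each at most `p` times. Before the last
pick, more elements are uncovered than the solution may leave out, and the surplus leaves a gap in
weak duality. So the number of the earlier picks is *strictly* less than `p m`, and as it is an
integer, there is room for the last pick (`Covering.Tight.picks_le`).

*Running time.* Dual variables and numbers of uncovered elements are functions of the sequence of
earlier picks alone. They can be written as nested sums over the positions in the lists of the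
relations and over earlier steps, where the number of the nested sums depends on the query only. So
it suffices to compile expressions with bounded sums (`RAM.LExp`) into programs. All sums have one
common bound, held in register `2`, whence the running time is a polynomial in this bound that can be
read off the syntax (`RAM.LExp.runs_compile`). The program (`ADP.CQ.program`) fills a table with the
picks, one evaluation of an expression per step, and then writes the picked tuples to the output.
-/

/-! ### Expressions with bounded sums, and their compilation -/

namespace RAM

/-- The memory with register `x` set to `v`. -/
def State.setReg (s : State) (x v : ℕ) : State := { s with reg := Function.update s.reg x v }

/-- The memory with cell `i` of array `a` set to `v`. -/
def State.setArr (s : State) (a i v : ℕ) : State :=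
  { s with arr := Function.update s.arr a (Function.update (s.arr a) i v) }

@[simp] lemma State.setReg_reg (s : State) (x v : ℕ) :
    (s.setReg x v).reg = Function.update s.reg x v := rfl

@[simp] lemma State.setReg_arr (s : State) (x v : ℕ) : (s.setReg x v).arr = s.arr := rfl

@[simp] lemma State.setArr_reg (s : State) (a i v : ℕ) : (s.setArr a i v).reg = s.reg := rfl

@[simp] lemma State.setArr_arr (s : State) (a i v : ℕ) :
    (s.setArr a i v).arr = Function.update s.arr a (Function.update (s.arr a) i v) := rfl

/-- Started in `s`, the program `c` terminates within `b` steps in a memory that satisfies `P`. -/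
def Runs (c : Program) (s : State) (b : ℕ) (P : State → Prop) : Prop :=
  ∃ t s', Exec c s t s' ∧ t ≤ b ∧ P s'

lemma Runs.weaken {c : Program} {s : State} {b b' : ℕ} {P P' : State → Prop} (h : Runs c s b P)
    (hb : b ≤ b') (hP : ∀ s', P s' → P' s') : Runs c s b' P' := by
  obtain ⟨t, s', h, ht, hs⟩ := h
  exact ⟨t, s', h, ht.trans hb, hP _ hs⟩

lemma Runs.skip {s : State} {P : State → Prop} (h : P s) : Runs .skip s 1 P :=
  ⟨1, s, .skip s, le_rfl, h⟩

lemma Runs.assign {x : ℕ} {e : Exp} {s : State} {P : State → Prop}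
    (h : P (s.setReg x (e.eval s))) : Runs (.assign x e) s (e.cost + 1) P :=
  ⟨_, _, .assign x e s, le_rfl, h⟩

lemma Runs.store {a : ℕ} {i e : Exp} {s : State} {P : State → Prop}
    (h : P (s.setArr a (i.eval s) (e.eval s))) : Runs (.store a i e) s (i.cost + e.cost + 1) P :=
  ⟨_, _, .store a i e s, le_rfl, h⟩

lemma Runs.seq {c d : Program} {s : State} {b b' : ℕ} {P Q : State → Prop} (hc : Runs c s b P)
    (hd : ∀ s', P s' → Runs d s' b' Q) : Runs (.seq c d) s (b + b') Q := by
  obtain ⟨t, s', h, ht, hs⟩ := hc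
  obtain ⟨t', s'', h', ht', hs'⟩ := hd s' hs
  exact ⟨_, _, .seq h h', add_le_add ht ht', hs'⟩

lemma Runs.ite {e : Exp} {c d : Program} {s : State} {b b' : ℕ} {P : State → Prop}
    (hc : e.eval s ≠ 0 → Runs c s b P) (hd : e.eval s = 0 → Runs d s b' P) :
    Runs (.ite e c d) s (e.cost + 1 + b + b') P := by
  by_cases h : e.eval s = 0
  · obtain ⟨t, s', h', ht, hs⟩ := hd h
    exact ⟨_, _, .ite_false h h', by omega, hs⟩
  · obtain ⟨t, s', h', ht, hs⟩ := hc h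
    exact ⟨_, _, .ite_true h h', by omega, hs⟩

/-- The loop `for reg x < reg 2 do c`. The bound of every loop is register `2`, which makes the
running time of a program a polynomial in that register that depends on the syntax alone. -/
def forLoop (x : ℕ) (c : Program) : Program :=
  .seq (.assign x (.const 0))
    (.whileDo (.sub (.reg 2) (.reg x)) (.seq c (.assign x (.add (.reg x) (.const 1)))))

lemma Runs.forLoop {x : ℕ} (hx : x ≠ 2) {c : Program} {s : State} {B b : ℕ} (hB : s.reg 2 = B)
    (Inv : ℕ → State → Prop) (h0 : Inv 0 (s.setReg x 0))
    (hstep : ∀ i < B, ∀ s', Inv i s' → s'.reg x = i → s'.reg 2 = B →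
      Runs c s' b fun s'' => s''.reg x = i ∧ s''.reg 2 = B ∧ Inv (i + 1) (s''.setReg x (i + 1))) :
    Runs (forLoop x c) s (B * (b + 8) + 6) (Inv B) := by
  have key : ∀ m i s', i + m = B → Inv i s' → s'.reg x = i → s'.reg 2 = B →
      Runs (.whileDo (.sub (.reg 2) (.reg x)) (.seq c (.assign x (.add (.reg x) (.const 1)))))
        s' (m * (b + 8) + 4) (Inv B) := by
    intro m
    induction m with
    | zero =>
      intro i s' hi hI hx' h2
      refine ⟨_, s', .while_false ?_, ?_, ?_⟩
      · simp only [Exp.eval]; omega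
      · simp [Exp.cost]
      · rwa [← hi]
    | succ m ih =>
      intro i s' hi hI hx' h2
      obtain ⟨t, s₁, he, ht, h₁, h₂, h₃⟩ := hstep i (by omega) s' hI hx' h2
      have he' : Exec (.seq c (.assign x (.add (.reg x) (.const 1)))) s' (t + 4)
          (s₁.setReg x (i + 1)) := by
        have := Exec.seq he (Exec.assign x (.add (.reg x) (.const 1)) s₁)
        simpa [Exp.cost, Exp.eval, h₁, State.setReg] using this
      obtain ⟨t', s₂, hw, ht', hs₂⟩ := ih (i + 1) (s₁.setReg x (i + 1)) (by omega) h₃ (by simp)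
        (by simp [Function.update_of_ne hx.symm, h₂])
      refine ⟨_, s₂, .while_true ?_ he' hw, ?_, hs₂⟩
      · simp only [Exp.eval]; omega
      · have : (m + 1) * (b + 8) = m * (b + 8) + (b + 8) := by ring
        simp only [Exp.cost]; omega
  have h := Runs.seq (P := fun s' => s' = s.setReg x 0)
    (Runs.assign (e := .const 0) (x := x) (s := s) rfl) (b' := B * (b + 8) + 4) (Q := Inv B)
    (d := .whileDo (.sub (.reg 2) (.reg x)) (.seq c (.assign x (.add (.reg x) (.const 1)))))
    (by
      rintro _ rfl
      exact key B 0 _ (by simp) h0 (by simp) (by simp [Function.update_of_ne hx.symm, hB]))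
  exact h.weaken (by simp only [Exp.cost]; omega) fun _ h => h

/-- Expressions with conditionals and bounded sums. All sums range over the numbers below one and
the same bound; their summation variables are named. -/
inductive LExp where
  | const (n : ℕ)
  | var (x : ℕ)
  | arr (a : ℕ) (i : LExp)
  | add (e f : LExp)
  | sub (e f : LExp)
  /-- `e` if the value of `c` is nonzero, and `f` otherwise -/
  | ite (c e f : LExp)
  /-- the sum of `e` over all values of the variable `x` below the bound -/
  | sum (x : ℕ) (e : LExp)

namespace LExp

/-- The value of an expression, where `B` is the bound of the sums, `A` gives the contents of the
arrays, and `ρ` the values of the variables. -/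
def eval (B : ℕ) (A : ℕ → ℕ → ℕ) : LExp → (ℕ → ℕ) → ℕ
  | const n, _ => n
  | var x, ρ => ρ x
  | arr a i, ρ => A a (i.eval B A ρ)
  | add e f, ρ => e.eval B A ρ + f.eval B A ρ
  | sub e f, ρ => e.eval B A ρ - f.eval B A ρ
  | ite c e f, ρ => if c.eval B A ρ = 0 then f.eval B A ρ else e.eval B A ρ
  | sum x e, ρ => ∑ i ∈ Finset.range B, e.eval B A (Function.update ρ x i)

/-- A program that writes the value of an expression into register `d`. The variable `x` stands in
register `σ x`, and only registers from `d` on are overwritten. -/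
def compile : LExp → (ℕ → ℕ) → ℕ → Program
  | const n, _, d => .assign d (.const n)
  | var x, σ, d => .assign d (.reg (σ x))
  | arr a i, σ, d => .seq (i.compile σ d) (.assign d (.arr a (.reg d)))
  | add e f, σ, d => .seq (e.compile σ d)
      (.seq (f.compile σ (d + 1)) (.assign d (.add (.reg d) (.reg (d + 1)))))
  | sub e f, σ, d => .seq (e.compile σ d)
      (.seq (f.compile σ (d + 1)) (.assign d (.sub (.reg d) (.reg (d + 1)))))
  | ite c e f, σ, d => .seq (c.compile σ d) (.ite (.reg d) (e.compile σ d) (f.compile σ d))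
  | sum x e, σ, d => .seq (.assign d (.const 0)) (forLoop (d + 1)
      (.seq (e.compile (Function.update σ x (d + 1)) (d + 2))
        (.assign d (.add (.reg d) (.reg (d + 2))))))

open Polynomial in
/-- A bound on the running time of the compiled expression, as a polynomial in the bound of the
sums. -/
noncomputable def time : LExp → Polynomial ℕ
  | const _ => 2
  | var _ => 2
  | arr _ i => i.time + 3
  | add e f => e.time + f.time + 4
  | sub e f => e.time + f.time + 4
  | ite c e f => c.time + e.time + f.time + 2
  | sum _ e => X * (e.time + 12) + 8

lemma runs_compile (e : LExp) : ∀ (σ : ℕ → ℕ) (d : ℕ) (s : State) (ρ : ℕ → ℕ) (B : ℕ), 2 < d →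
    (∀ y, σ y < d) → s.reg 2 = B → (∀ y, s.reg (σ y) = ρ y) →
    Runs (e.compile σ d) s (e.time.eval B) fun s' =>
      s'.arr = s.arr ∧ s'.reg d = e.eval B s.arr ρ ∧ ∀ y < d, s'.reg y = s.reg y := by
  have upd : ∀ (s : State) (d v : ℕ), ∀ y < d, (s.setReg d v).reg y = s.reg y :=
    fun s d v y hy => by simp [Function.update_of_ne hy.ne]
  induction e with
  | const n =>
    intro σ d s ρ B hd hσ hB hρ
    exact (Runs.assign ⟨rfl, by simp [Exp.eval, eval], upd _ _ _⟩).weaken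
      (by simp [time, Exp.cost]) fun _ h => h
  | var x =>
    intro σ d s ρ B hd hσ hB hρ
    exact (Runs.assign ⟨rfl, by simp [Exp.eval, eval, hρ], upd _ _ _⟩).weaken
      (by simp [time, Exp.cost]) fun _ h => h
  | arr a i ih =>
    intro σ d s ρ B hd hσ hB hρ
    refine ((ih σ d s ρ B hd hσ hB hρ).seq
      (b' := 3) ?_).weaken (by simp [time]) fun _ h => h
    rintro s₁ ⟨h₁, h₂, h₃⟩
    refine (Runs.assign (e := .arr a (.reg d)) ⟨h₁, ?_, fun y hy => ?_⟩).weaken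
      (by simp [Exp.cost]) fun _ h => h
    · simp [Exp.eval, eval, h₁, h₂]
    · rw [upd _ _ _ _ hy, h₃ y hy]
  | add e f ihe ihf =>
    intro σ d s ρ B hd hσ hB hρ
    refine ((ihe σ d s ρ B hd hσ hB hρ).seq (b' := f.time.eval B + 4) ?_).weaken
      (by simp [time, add_assoc]) fun _ h => h
    rintro s₁ ⟨h₁, h₂, h₃⟩
    refine (ihf σ (d + 1) s₁ ρ B (by omega) (fun y => (hσ y).trans (by omega))
      (by rw [h₃ 2 hd, hB]) (fun y => by rw [h₃ _ (hσ y), hρ])).seq (b' := 4) ?_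
    rintro s₂ ⟨h₁', h₂', h₃'⟩
    refine (Runs.assign (e := .add (.reg d) (.reg (d + 1))) ⟨?_, ?_, fun y hy => ?_⟩).weaken
      (by simp [Exp.cost]) fun _ h => h
    · simp [h₁', h₁]
    · simp [Exp.eval, eval, h₁, h₂, h₂', h₃' d (by omega)]
    · rw [upd _ _ _ _ hy, h₃' y (by omega), h₃ y hy]
  | sub e f ihe ihf =>
    intro σ d s ρ B hd hσ hB hρ
    refine ((ihe σ d s ρ B hd hσ hB hρ).seq (b' := f.time.eval B + 4) ?_).weaken
      (by simp [time, add_assoc]) fun _ h => h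
    rintro s₁ ⟨h₁, h₂, h₃⟩
    refine (ihf σ (d + 1) s₁ ρ B (by omega) (fun y => (hσ y).trans (by omega))
      (by rw [h₃ 2 hd, hB]) (fun y => by rw [h₃ _ (hσ y), hρ])).seq (b' := 4) ?_
    rintro s₂ ⟨h₁', h₂', h₃'⟩
    refine (Runs.assign (e := .sub (.reg d) (.reg (d + 1))) ⟨?_, ?_, fun y hy => ?_⟩).weaken
      (by simp [Exp.cost]) fun _ h => h
    · simp [h₁', h₁]
    · simp [Exp.eval, eval, h₁, h₂, h₂', h₃' d (by omega)]
    · rw [upd _ _ _ _ hy, h₃' y (by omega), h₃ y hy]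
  | ite c e f ihc ihe ihf =>
    intro σ d s ρ B hd hσ hB hρ
    refine ((ihc σ d s ρ B hd hσ hB hρ).seq (b' := 2 + e.time.eval B + f.time.eval B) ?_).weaken
      (by simp [time]; omega) fun _ h => h
    rintro s₁ ⟨h₁, h₂, h₃⟩
    have hB' : s₁.reg 2 = B := by rw [h₃ 2 hd, hB]
    have hρ' : ∀ y, s₁.reg (σ y) = ρ y := fun y => by rw [h₃ _ (hσ y), hρ]
    refine Runs.ite (e := .reg d) (fun h => ?_) fun h => ?_
    · refine (ihe σ d s₁ ρ B hd hσ hB' hρ').weaken le_rfl ?_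
      rintro s₂ ⟨h₁', h₂', h₃'⟩
      simp only [Exp.eval, h₂] at h
      refine ⟨by rw [h₁', h₁], by simp [eval, h, h₂', h₁], fun y hy => by rw [h₃' y hy, h₃ y hy]⟩
    · refine (ihf σ d s₁ ρ B hd hσ hB' hρ').weaken le_rfl ?_
      rintro s₂ ⟨h₁', h₂', h₃'⟩
      simp only [Exp.eval, h₂] at h
      refine ⟨by rw [h₁', h₁], by simp [eval, h, h₂', h₁], fun y hy => by rw [h₃' y hy, h₃ y hy]⟩
  | sum x e ih =>
    intro σ d s ρ B hd hσ hB hρ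
    refine ((Runs.assign (e := .const 0) (P := fun s' => s' = s.setReg d 0) rfl).seq
      (b' := B * ((e.time.eval B + 4) + 8) + 6) ?_).weaken
      (by simp [time, Exp.cost, add_assoc]; omega) fun _ h => h
    rintro _ rfl
    refine (Runs.forLoop (by omega) (B := B)
      (by simp [Function.update_of_ne hd.ne, hB]) (fun i s' => s'.arr = s.arr ∧
        s'.reg d = ∑ j ∈ Finset.range i, e.eval B s.arr (Function.update ρ x j) ∧
        ∀ y < d, s'.reg y = s.reg y) ?_ ?_).weaken le_rfl fun _ h => h
    · refine ⟨rfl, by simp, fun y hy => ?_⟩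
      rw [upd _ _ _ _ (by omega), upd _ _ _ _ hy]
    · rintro i hi s₁ ⟨h₁, h₂, h₃⟩ hx h2
      refine (ih (Function.update σ x (d + 1)) (d + 2) s₁ (Function.update ρ x i) B (by omega)
        (fun y => ?_) h2 (fun y => ?_)).seq (b' := 4) ?_
      · rcases eq_or_ne y x with rfl | hy
        · simp
        · rw [Function.update_of_ne hy]
          exact (hσ y).trans (by omega)
      · rcases eq_or_ne y x with rfl | hy
        · simpa using hx
        · rw [Function.update_of_ne hy, Function.update_of_ne hy, h₃ _ (hσ y), hρ]
      · rintro s₂ ⟨h₁', h₂', h₃'⟩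
        refine (Runs.assign (e := .add (.reg d) (.reg (d + 2))) ⟨?_, ?_, ?_, ?_, ?_⟩).weaken
          (by simp [Exp.cost]) fun _ h => h
        · simp [h₃' (d + 1) (by omega), hx]
        · rw [upd _ _ _ _ hd, h₃' 2 (by omega), h2]
        · simp [h₁, h₁']
        · simp [Exp.eval, h₂', h₃' d (by omega), h₂, Finset.sum_range_succ, h₁]
        · intro y hy
          rw [upd _ _ _ _ (by omega), upd _ _ _ _ hy, h₃' y (by omega), h₃ y hy]

end LExp

/-! ### Statements over these expressions -/

/-- The registers `0, …, 4` hold the variables of a program; the compiled expressions use the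
registers from `5` on. Variables from `5` on occur only as summation variables, so their value here
does not matter. -/
def State.env (s : State) : ℕ → ℕ := fun y => s.reg (if y < 5 then y else 0)

/-- The value of an expression in a memory, with register `2` as the bound of the sums. -/
def State.val (s : State) (e : LExp) : ℕ := e.eval (s.reg 2) s.arr s.env

/-- Equality of two memories up to the registers used by compiled expressions. -/
def State.Same (s s' : State) : Prop := s.arr = s'.arr ∧ ∀ y < 5, s.reg y = s'.reg y

lemma State.Same.val_eq {s s' : State} (h : s.Same s') (e : LExp) : s.val e = s'.val e := by
  have : s.env = s'.env := by
    funext y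
    simp only [State.env]
    exact h.2 _ (by split_ifs <;> omega)
  rw [State.val, State.val, h.1, h.2 2 (by omega), this]

lemma State.Same.setReg {s s' : State} (h : s.Same s') (x v : ℕ) :
    (s.setReg x v).Same (s'.setReg x v) := by
  refine ⟨h.1, fun y hy => ?_⟩
  rcases eq_or_ne y x with rfl | hy'
  · simp
  · simp [Function.update_of_ne hy', h.2 y hy]

lemma State.Same.setArr {s s' : State} (h : s.Same s') (a i v : ℕ) :
    (s.setArr a i v).Same (s'.setArr a i v) :=
  ⟨by simp [h.1], h.2⟩

lemma State.Same.trans {s s' s'' : State} (h : s.Same s') (h' : s'.Same s'') : s.Same s'' :=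
  ⟨h.1.trans h'.1, fun y hy => (h.2 y hy).trans (h'.2 y hy)⟩

/-- Write the value of `e` into register `d ≥ 5`. -/
def compute (d : ℕ) (e : LExp) : Program := e.compile (fun y => if y < 5 then y else 0) d

lemma runs_compute {d : ℕ} (hd : 5 ≤ d) (e : LExp) (s : State) :
    Runs (compute d e) s (e.time.eval (s.reg 2)) fun s' =>
      s'.Same s ∧ s'.reg d = s.val e ∧ ∀ y < d, s'.reg y = s.reg y := by
  refine (e.runs_compile _ d s s.env _ (by omega) (fun y => by split_ifs <;> omega) rfl
    (fun y => rfl)).weaken le_rfl ?_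
  rintro s' ⟨h₁, h₂, h₃⟩
  exact ⟨⟨h₁, fun y hy => h₃ y (by omega)⟩, h₂, h₃⟩

/-- `reg x := e` -/
def setVar (x : ℕ) (e : LExp) : Program := .seq (compute 5 e) (.assign x (.reg 5))

lemma runs_setVar (x : ℕ) (e : LExp) (s : State) :
    Runs (setVar x e) s (e.time.eval (s.reg 2) + 2) fun s' =>
      s'.Same (s.setReg x (s.val e)) := by
  refine (runs_compute le_rfl e s).seq ?_
  rintro s₁ ⟨h₁, h₂, -⟩
  refine Runs.assign (e := .reg 5) ?_
  rw [Exp.eval, h₂]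
  exact h₁.setReg _ _

/-- `arr a i := e` -/
def setCell (a : ℕ) (i e : LExp) : Program :=
  .seq (compute 5 i) (.seq (compute 6 e) (.store a (.reg 5) (.reg 6)))

lemma runs_setCell (a : ℕ) (i e : LExp) (s : State) :
    Runs (setCell a i e) s (i.time.eval (s.reg 2) + (e.time.eval (s.reg 2) + 3)) fun s' =>
      s'.Same (s.setArr a (s.val i) (s.val e)) := by
  refine (runs_compute le_rfl i s).seq ?_
  rintro s₁ ⟨h₁, h₂, -⟩
  rw [← h₁.2 2 (by omega)]
  refine (runs_compute (by omega) e s₁).seq ?_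
  rintro s₂ ⟨h₁', h₂', h₃'⟩
  refine Runs.store (i := .reg 5) (e := .reg 6) ?_
  rw [Exp.eval, Exp.eval, h₂', h₃' 5 (by omega), h₂, h₁.val_eq]
  exact (h₁'.trans h₁).setArr _ _ _

/-- Append the value of `e` to the output. -/
def push (e : LExp) : Program := .seq (setCell 1 (.var 1) e) (setVar 1 (.add (.var 1) (.const 1)))

/-- Execute `c` if the value of `e` is nonzero. -/
def when (e : LExp) (c : Program) : Program := .seq (compute 5 e) (.ite (.reg 5) c .skip)

end RAM

/-! ### Covering a prescribed number of elements by few sets -/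

namespace Covering

open Finset

variable {ε : Type*} (E : Finset ε) (mem : ℕ → ε → Prop) (P : ℕ → ℕ)

/-- A run of a covering algorithm is a sequence `P`: in step `t`, the set `g` is picked if
`P t = g + 1`, and no set is picked if `P t = 0`. The element `e` is active at time `t` if it lies in
no set that is picked before. -/
def Active (t : ℕ) (e : ε) : Prop := ∀ t' < t, ∀ g, P t' = g + 1 → ¬ mem g e

open Classical in
/-- The number of active elements of the set `g` at time `t`. -/
noncomputable def gain (t g : ℕ) : ℕ := #{e ∈ E | Active mem P t e ∧ mem g e}

open Classical in
/-- The number of elements that are covered before time `t`. -/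
noncomputable def covered (t : ℕ) : ℕ := #{e ∈ E | ¬ Active mem P t e}

/-- The number of sets that are picked before time `t`. -/
def picks (t : ℕ) : ℕ := #{t' ∈ range t | P t' ≠ 0}

/-- The number of steps before time `t` that pick no set. -/
def pauses (t : ℕ) : ℕ := #{t' ∈ range t | P t' = 0}

/-- If every step without a pick raises the dual variable of each active element by one, this is the
sum of the dual variables of the set `g` at time `t`. -/
noncomputable def load (t g : ℕ) : ℕ := ∑ t' ∈ range t with P t' = 0, gain E mem P t' g

/-- The sets that are picked before time `t`. -/
def picked (t : ℕ) : Finset ℕ := {t' ∈ range t | P t' ≠ 0}.image fun t' => P t' - 1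

/-- The first `B` steps of the algorithm that aims at covering `k` elements and picks, until this is
reached, some good set whenever there is one among the sets `g < B`. -/
structure IsRun (k B : ℕ) (good : ℕ → ℕ → Prop) : Prop where
  pick : ∀ t < B, ∀ g, P t = g + 1 → covered E mem P t < k ∧ g < B ∧ good t g
  pause : ∀ t < B, P t = 0 → covered E mem P t < k → ∀ g < B, ¬ good t g

/-- The greedy rule: `g` covers as many active elements as possible. -/
def Greedy (B t g : ℕ) : Prop := ∀ g' < B, gain E mem P t g' ≤ gain E mem P t g

/-- The primal-dual rule: `g` has active elements, and its dual constraint is tight, up to the scaling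
of the dual variables by `N`. -/
def Tight (N t g : ℕ) : Prop := 0 < gain E mem P t g ∧ N ≤ load E mem P t g

variable {E mem P}

lemma active_succ {t : ℕ} {e : ε} :
    Active mem P (t + 1) e ↔ Active mem P t e ∧ ∀ g, P t = g + 1 → ¬ mem g e := by
  refine ⟨fun h => ⟨fun t' ht' => h t' (by omega), h t (by omega)⟩, fun h t' ht' => ?_⟩
  rcases (Nat.lt_succ_iff_lt_or_eq).1 ht' with h' | rfl
  exacts [h.1 t' h', h.2]

lemma Active.anti {t t' : ℕ} (htt : t ≤ t') {e : ε} (h : Active mem P t' e) : Active mem P t e :=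
  fun s hs => h s (by omega)

lemma mem_picked {t g : ℕ} : g ∈ picked P t ↔ ∃ t' < t, P t' = g + 1 := by
  simp only [picked, mem_image, mem_filter, mem_range]
  constructor
  · rintro ⟨t', ⟨ht', h0⟩, hg⟩
    exact ⟨t', ht', by omega⟩
  · rintro ⟨t', ht', hg⟩
    exact ⟨t', ⟨ht', by omega⟩, by omega⟩

lemma not_active_iff {t : ℕ} {e : ε} : ¬ Active mem P t e ↔ ∃ g ∈ picked P t, mem g e := by
  simp only [Active, mem_picked]
  push Not
  exact ⟨fun ⟨t', ht', g, hg, h⟩ => ⟨g, ⟨t', ht', hg⟩, h⟩,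
    fun ⟨g, ⟨t', ht', hg⟩, h⟩ => ⟨t', ht', g, hg, h⟩⟩

lemma card_picked_le (t : ℕ) : #(picked P t) ≤ picks P t := card_image_le

@[simp] lemma covered_zero : covered E mem P 0 = 0 := by
  classical simp [covered, Active]

lemma covered_succ_of_eq_zero {t : ℕ} (h : P t = 0) :
    covered E mem P (t + 1) = covered E mem P t := by
  classical
  rw [covered, covered]
  congr 1
  ext e
  simp [active_succ, h]

lemma covered_succ {t g : ℕ} (h : P t = g + 1) :
    covered E mem P (t + 1) = covered E mem P t + gain E mem P t g := by
  classical
  rw [covered, covered, gain, ← card_union_of_disjoint]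
  · congr 1
    ext e
    simp only [active_succ, h, mem_filter, mem_union, Nat.succ_inj]
    constructor
    · rintro ⟨he, h'⟩
      by_cases ha : Active mem P t e
      · refine .inr ⟨he, ha, ?_⟩
        by_contra hg
        exact h' ⟨ha, by rintro _ rfl; exact hg⟩
      · exact .inl ⟨he, ha⟩
    · rintro (⟨he, h'⟩ | ⟨he, -, h'⟩)
      · exact ⟨he, fun h => h' h.1⟩
      · exact ⟨he, fun h => h.2 g rfl h'⟩
  · rw [disjoint_filter]
    exact fun e _ h h' => h h'.1

lemma covered_mono : Monotone (covered E mem P) := by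
  classical
  exact fun t t' h => card_le_card (monotone_filter_right _ fun e _ he ha => he (ha.anti h))

lemma gain_le (t g : ℕ) : gain E mem P t g ≤ #E := by
  classical exact card_filter_le _ _

lemma card_active (t : ℕ) [DecidablePred (Active mem P t)] :
    #{e ∈ E | Active mem P t e} + covered E mem P t = #E := by
  classical
  rw [covered, ← card_filter_add_card_filter_not (s := E) (Active mem P t)]
  congr!

lemma gain_pos_iff {t g : ℕ} : 0 < gain E mem P t g ↔ ∃ e ∈ E, Active mem P t e ∧ mem g e := by
  classical
  rw [gain, card_pos]
  simp [Finset.Nonempty]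

lemma exists_active {t k : ℕ} (hk : k ≤ #E) (h : covered E mem P t < k) :
    ∃ e ∈ E, Active mem P t e := by
  classical
  have := card_active (E := E) (mem := mem) (P := P) t
  have h' : 0 < #{e ∈ E | Active mem P t e} := by omega
  obtain ⟨e, he⟩ := card_pos.1 h'
  exact ⟨e, (mem_filter.1 he).1, (mem_filter.1 he).2⟩

section Congr

variable {P' : ℕ → ℕ} {t : ℕ} (h : ∀ t' < t, P t' = P' t')

include h

lemma active_congr (e : ε) : Active mem P t e ↔ Active mem P' t e :=
  forall₂_congr fun t' ht' => by rw [h t' ht']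

lemma covered_congr : covered E mem P t = covered E mem P' t := by
  classical
  rw [covered, covered]
  congr 1
  ext e
  simp [active_congr h]

lemma gain_congr (g : ℕ) : gain E mem P t g = gain E mem P' t g := by
  classical
  rw [gain, gain]
  congr 1
  ext e
  simp [active_congr h]

lemma load_congr (g : ℕ) : load E mem P t g = load E mem P' t g := by
  rw [load, load, sum_filter, sum_filter]
  refine sum_congr rfl fun t' ht' => ?_
  have ht' := mem_range.1 ht'
  rw [h t' ht', gain_congr fun t'' ht'' => h t'' (ht''.trans ht')]

lemma greedy_congr {B g : ℕ} : Greedy E mem P B t g ↔ Greedy E mem P' B t g := by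
  simp only [Greedy, gain_congr h]

lemma tight_congr {N g : ℕ} : Tight E mem P N t g ↔ Tight E mem P' N t g := by
  simp only [Tight, gain_congr h, load_congr h]

end Congr

lemma picks_succ (t : ℕ) : picks P (t + 1) = picks P t + if P t = 0 then 0 else 1 := by
  by_cases h : P t = 0 <;> simp [picks, range_add_one, filter_insert, h]

lemma pauses_succ (t : ℕ) : pauses P (t + 1) = pauses P t + if P t = 0 then 1 else 0 := by
  by_cases h : P t = 0 <;> simp [pauses, range_add_one, filter_insert, h]

lemma picks_add_pauses (t : ℕ) : picks P t + pauses P t = t := by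
  rw [picks, pauses, add_comm, card_filter_add_card_filter_not, card_range]

/-- After `k` elements are covered, no further set is picked. -/
lemma IsRun.picks_eq {k B : ℕ} {good : ℕ → ℕ → Prop} (h : IsRun E mem P k B good) {T : ℕ}
    (hT : T ≤ B) (hk : k ≤ covered E mem P T) : picks P B = picks P T := by
  have : ∀ t, T ≤ t → t ≤ B → picks P t = picks P T := by
    intro t ht
    induction t, ht using Nat.le_induction with
    | base => exact fun _ => rfl
    | succ t ht ih =>
      intro hB
      rw [picks_succ, ih (by omega), if_pos]
      · simp
      by_contra h0
      obtain ⟨g, hg⟩ := Nat.exists_eq_succ_of_ne_zero h0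
      have := (h.pick t (by omega) g hg).1
      have := covered_mono (E := E) (mem := mem) (P := P) ht
      omega
  exact this B hT le_rfl

/-- The active elements of the sets of a solution make up for what is missing to `k` covered
elements. -/
lemma le_sum_gain {k t : ℕ} {S : Finset ℕ}
    (hS : ∃ F ⊆ E, k ≤ #F ∧ ∀ e ∈ F, ∃ g ∈ S, mem g e) :
    k ≤ covered E mem P t + ∑ g ∈ S, gain E mem P t g := by
  classical
  obtain ⟨F, hFE, hF, hFS⟩ := hS
  calc k ≤ #F := hF
    _ ≤ #(E.filter (fun e => ¬ Active mem P t e) ∪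
          S.biUnion fun g => E.filter fun e => Active mem P t e ∧ mem g e) := by
        refine card_le_card fun e he => ?_
        obtain ⟨g, hg, hge⟩ := hFS e he
        by_cases ha : Active mem P t e
        · exact mem_union_right _ (mem_biUnion.2 ⟨g, hg, mem_filter.2 ⟨hFE he, ha, hge⟩⟩)
        · exact mem_union_left _ (mem_filter.2 ⟨hFE he, ha⟩)
    _ ≤ _ := (card_union_le _ _).trans (add_le_add (by rw [covered]) (by
        refine card_biUnion_le.trans (le_of_eq ?_)
        simp only [gain]))

section Greedy

variable {k B : ℕ} (hrun : IsRun E mem P k B (Greedy E mem P B))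
  (hlt : ∀ e ∈ E, ∀ g, mem g e → g < B) (hex : ∀ e ∈ E, ∃ g, mem g e) (hkE : k ≤ #E)

include hrun hlt hex hkE

lemma Greedy.step {t : ℕ} (ht : t < B) (h : covered E mem P t < k) :
    ∃ g, P t = g + 1 ∧ 0 < gain E mem P t g ∧ ∀ g', gain E mem P t g' ≤ gain E mem P t g := by
  obtain ⟨e, he, ha⟩ := exists_active hkE h
  obtain ⟨g₀, hg₀⟩ := hex e he
  have hg₀B := hlt e he g₀ hg₀
  have h0 : P t ≠ 0 := by
    intro h0
    obtain ⟨g, hg, hmax⟩ := exists_max_image (range B) (gain E mem P t) ⟨g₀, by simpa⟩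
    exact hrun.pause t ht h0 h g (mem_range.1 hg) fun g' hg' => hmax g' (mem_range.2 hg')
  obtain ⟨g, hg⟩ := Nat.exists_eq_succ_of_ne_zero h0
  obtain ⟨-, -, hgood⟩ := hrun.pick t ht g hg
  refine ⟨g, hg, (gain_pos_iff.2 ⟨e, he, ha, hg₀⟩).trans_le (hgood g₀ hg₀B), fun g' => ?_⟩
  rcases Nat.eq_zero_or_pos (gain E mem P t g') with h' | h'
  · omega
  · obtain ⟨e', he', -, hm⟩ := gain_pos_iff.1 h'
    exact hgood g' (hlt e' he' g' hm)

lemma Greedy.le_covered {t : ℕ} (ht : t ≤ B) (h : covered E mem P t < k) :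
    t ≤ covered E mem P t := by
  induction t with
  | zero => simp
  | succ t ih =>
    have h' := (covered_mono (E := E) (mem := mem) (P := P) (Nat.le_succ t)).trans_lt h
    obtain ⟨g, hg, hpos, -⟩ := Greedy.step hrun hlt hex hkE ht h'
    have := ih (by omega) h'
    rw [covered_succ hg]
    omega

/-- The greedy algorithm covers `k` elements. -/
lemma Greedy.covers (hkB : k ≤ B) : k ≤ covered E mem P B := by
  by_contra! h
  have := Greedy.le_covered hrun hlt hex hkE le_rfl h
  omega

/-- With `m` the size of a solution, each step reduces what is missing by a factor `1 - 1/m`. -/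
lemma Greedy.missing_le {S : Finset ℕ} (hm : 0 < #S)
    (hS : ∃ F ⊆ E, k ≤ #F ∧ ∀ e ∈ F, ∃ g ∈ S, mem g e) {t : ℕ} (ht : t ≤ B)
    (h : covered E mem P t < k) :
    (k : ℝ) - covered E mem P t ≤ k * Real.exp (-(t / #S : ℝ)) := by
  have hm' : (0 : ℝ) < #S := by exact_mod_cast hm
  induction t with
  | zero => simp
  | succ t ih =>
    have h' := (covered_mono (E := E) (mem := mem) (P := P) (Nat.le_succ t)).trans_lt h
    obtain ⟨g, hg, hpos, hmax⟩ := Greedy.step hrun hlt hex hkE ht h'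
    have ih := ih (by omega) h'
    have h₁ : k ≤ covered E mem P t + #S * gain E mem P t g := by
      refine (le_sum_gain (P := P) (t := t) hS).trans ?_
      gcongr
      exact (sum_le_card_nsmul _ _ _ fun g' _ => hmax g').trans (by simp)
    have h₁' : (k : ℝ) - covered E mem P t ≤ #S * gain E mem P t g := by
      have : (k : ℝ) ≤ covered E mem P t + #S * gain E mem P t g := by exact_mod_cast h₁
      linarith
    have h₂ : 1 - 1 / (#S : ℝ) ≤ Real.exp (-(1 / #S : ℝ)) := by
      linarith [Real.add_one_le_exp (-(1 / #S : ℝ))]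
    have h₃ : (0 : ℝ) ≤ k - covered E mem P t := by
      have : (covered E mem P t : ℝ) ≤ k := by exact_mod_cast h'.le
      linarith
    calc (k : ℝ) - covered E mem P (t + 1)
        = (k - covered E mem P t) - gain E mem P t g := by rw [covered_succ hg]; push_cast; ring
      _ ≤ (k - covered E mem P t) - (k - covered E mem P t) / #S := by
          gcongr
          rw [div_le_iff₀ hm']
          linarith
      _ = (k - covered E mem P t) * (1 - 1 / #S) := by ring
      _ ≤ (k - covered E mem P t) * Real.exp (-(1 / #S : ℝ)) := by gcongr
      _ ≤ (k * Real.exp (-(t / #S : ℝ))) * Real.exp (-(1 / #S : ℝ)) := by gcongr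
      _ = k * Real.exp (-((t + 1 : ℕ) / #S : ℝ)) := by
          rw [mul_assoc, ← Real.exp_add]
          congr 2
          push_cast
          ring

/-- The greedy algorithm picks at most `1 + m log k` sets. -/
theorem Greedy.picks_le (hk : 1 ≤ k) (hkB : k ≤ B) {S : Finset ℕ}
    (hS : ∃ F ⊆ E, k ≤ #F ∧ ∀ e ∈ F, ∃ g ∈ S, mem g e) :
    (picks P B : ℝ) ≤ (1 + Real.log k) * #S := by
  classical
  have hm : 0 < #S := by
    obtain ⟨F, -, hF, hFS⟩ := hS
    obtain ⟨e, he⟩ := card_pos.1 (hk.trans hF)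
    obtain ⟨g, hg, -⟩ := hFS e he
    exact card_pos.2 ⟨g, hg⟩
  have hex' : ∃ T, k ≤ covered E mem P T := ⟨B, Greedy.covers hrun hlt hex hkE hkB⟩
  obtain ⟨T, hT⟩ : ∃ T, T = Nat.find hex' := ⟨_, rfl⟩
  have hTk : k ≤ covered E mem P T := hT ▸ Nat.find_spec hex'
  have hTB : T ≤ B := hT ▸ Nat.find_min' hex' (Greedy.covers hrun hlt hex hkE hkB)
  rw [hrun.picks_eq hTB hTk]
  have hp : picks P T ≤ T := by have := picks_add_pauses (P := P) T; omega
  obtain _ | t := T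
  · simp at hTk; omega
  have hlt' : covered E mem P t < k := by
    by_contra! h
    have := Nat.find_min' hex' h
    omega
  have h := Greedy.missing_le hrun hlt hex hkE hm hS (by omega) hlt'
  have h1 : (1 : ℝ) ≤ k - covered E mem P t := by
    have : (covered E mem P t + 1 : ℝ) ≤ k := by exact_mod_cast hlt'
    linarith
  have hk0 : (0 : ℝ) < k := by exact_mod_cast hk
  have hm1 : (1 : ℝ) ≤ #S := by exact_mod_cast hm
  have h2 := Real.log_le_log one_pos (h1.trans h)
  rw [Real.log_one, Real.log_mul hk0.ne' (Real.exp_pos _).ne', Real.log_exp] at h2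
  have h3 : (t : ℝ) ≤ Real.log k * #S := by
    rw [← div_le_iff₀ (by linarith)]
    linarith
  have hp' : (picks P (t + 1) : ℝ) ≤ t + 1 := by exact_mod_cast hp
  linarith

end Greedy

section PrimalDual

open Classical in
/-- The dual variable of the element `e` at time `t`. -/
noncomputable def dual (mem : ℕ → ε → Prop) (P : ℕ → ℕ) (t : ℕ) (e : ε) : ℕ :=
  #{t' ∈ range t | P t' = 0 ∧ Active mem P t' e}

lemma dual_le (t : ℕ) (e : ε) : dual mem P t e ≤ pauses P t := by
  classical
  exact card_le_card (monotone_filter_right _ fun t' _ h => h.1)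

lemma dual_eq {t : ℕ} {e : ε} (h : Active mem P t e) : dual mem P t e = pauses P t := by
  classical
  rw [dual, pauses]
  congr 1
  refine filter_congr fun t' ht' => ?_
  simp [h.anti (mem_range.1 ht').le]

lemma load_eq (t g : ℕ) [DecidablePred (mem g)] :
    load E mem P t g = ∑ e ∈ E with mem g e, dual mem P t e := by
  classical
  have h₁ : load E mem P t g = ∑ t' ∈ range t, ∑ e ∈ E,
      if P t' = 0 ∧ Active mem P t' e ∧ mem g e then 1 else 0 := by
    rw [load, sum_filter]
    refine sum_congr rfl fun t' _ => ?_
    rw [gain, card_filter]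
    split_ifs with h
    · simp only [h, true_and]
      congr!
    · simp [h]
  rw [h₁, sum_comm, sum_filter]
  refine sum_congr rfl fun e _ => ?_
  split_ifs with h <;> simp [h, dual]

lemma load_mono (g : ℕ) : Monotone fun t => load E mem P t g := fun _ _ h =>
  sum_le_sum_of_subset (filter_subset_filter _ (range_mono h))

lemma load_succ (t g : ℕ) :
    load E mem P (t + 1) g = load E mem P t g + if P t = 0 then gain E mem P t g else 0 := by
  by_cases h : P t = 0 <;> simp [load, range_add_one, filter_insert, h, add_comm]

variable {N k B : ℕ} (hrun : IsRun E mem P k B (Tight E mem P N))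
  (hlt : ∀ e ∈ E, ∀ g, mem g e → g < B) (hkE : k ≤ #E)

include hrun in
lemma Tight.picks_le_covered {t : ℕ} (ht : t ≤ B) : picks P t ≤ covered E mem P t := by
  induction t with
  | zero => simp [picks]
  | succ t ih =>
    have ih := ih (by omega)
    rw [picks_succ]
    by_cases h0 : P t = 0
    · simpa [h0, covered_succ_of_eq_zero h0] using ih
    · obtain ⟨g, hg⟩ := Nat.exists_eq_succ_of_ne_zero h0
      have := (hrun.pick t (by omega) g hg).2.2.1
      rw [covered_succ hg, if_neg h0]
      omega

include hrun hlt in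
/-- The dual constraints are violated at most by one round of raising the dual variables. -/
lemma Tight.load_le {t : ℕ} (ht : t ≤ B) (h : ∀ t' < t, covered E mem P t' < k) (g : ℕ) :
    load E mem P t g ≤ N + #E := by
  induction t with
  | zero => simp [load]
  | succ t ih =>
    have ih := ih (by omega) fun t' ht' => h t' (by omega)
    rw [load_succ]
    split_ifs with h0
    · rcases Nat.eq_zero_or_pos (gain E mem P t g) with h' | h'
      · omega
      · obtain ⟨e, he, -, hm⟩ := gain_pos_iff.1 h'
        have h'' := hrun.pause t (by omega) h0 (h t (by omega)) g (hlt e he g hm)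
        have : load E mem P t g < N := by
          by_contra! hN
          exact h'' ⟨h', hN⟩
        have := gain_le (E := E) (mem := mem) (P := P) t g
        omega
    · exact ih

include hrun hlt hkE in
/-- The primal-dual algorithm covers `k` elements. -/
lemma Tight.covers (hex : ∀ e ∈ E, ∃ g, mem g e) (hB : N + #E < B) :
    k ≤ covered E mem P B := by
  by_contra! h
  obtain ⟨e, he, ha⟩ := exists_active hkE h
  obtain ⟨g, hg⟩ := hex e he
  have hgB := hlt e he g hg
  have key : ∀ t ≤ B, pauses P t ≤ N ∧ pauses P t ≤ load E mem P t g := by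
    intro t
    induction t with
    | zero => simp [pauses]
    | succ t ih =>
      intro ht
      obtain ⟨ih₁, ih₂⟩ := ih (by omega)
      have hpos : 0 < gain E mem P t g := gain_pos_iff.2 ⟨e, he, ha.anti (by omega), hg⟩
      rw [pauses_succ, load_succ]
      split_ifs with h0
      · have h'' := hrun.pause t (by omega) h0
          ((covered_mono (by omega : t ≤ B)).trans_lt h) g hgB
        have : load E mem P t g < N := by
          by_contra! hN
          exact h'' ⟨hpos, hN⟩
        omega
      · omega
  have h₁ := (key B le_rfl).1
  have h₂ := Tight.picks_le_covered hrun le_rfl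
  have h₃ := picks_add_pauses (P := P) B
  omega

include hrun in
/-- Every picked set pays with the dual variables of its elements, and each element pays for at most
`p` picked sets. -/
lemma Tight.picks_mul_le {p : ℕ} (hp : ∀ e ∈ E, ∃ G : Finset ℕ, #G ≤ p ∧ ∀ g, mem g e → g ∈ G)
    {t : ℕ} (ht : t ≤ B) [DecidablePred (Active mem P t)] :
    picks P t * N ≤ p * ∑ e ∈ E with ¬ Active mem P t e, dual mem P t e := by
  classical
  calc picks P t * N = ∑ t' ∈ range t with P t' ≠ 0, N := by rw [sum_const, picks, smul_eq_mul]
    _ ≤ ∑ t' ∈ range t with P t' ≠ 0, load E mem P t (P t' - 1) := by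
        refine sum_le_sum fun t' ht' => ?_
        obtain ⟨ht', h0⟩ := mem_filter.1 ht'
        have ht' := mem_range.1 ht'
        exact (hrun.pick t' (by omega) (P t' - 1) (by omega)).2.2.2.trans (load_mono _ ht'.le)
    _ = ∑ e ∈ E, ∑ t' ∈ range t with P t' ≠ 0, if mem (P t' - 1) e then dual mem P t e else 0 := by
        simp only [load_eq, sum_filter (s := E)]
        exact sum_comm
    _ ≤ ∑ e ∈ E, if ¬ Active mem P t e then p * dual mem P t e else 0 := by
        refine sum_le_sum fun e he => ?_
        rw [← sum_filter, sum_const, smul_eq_mul]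
        by_cases h : Active mem P t e
        swap
        · rw [if_pos h]
          refine Nat.mul_le_mul_right _ ?_
          obtain ⟨G, hG, hm⟩ := hp e he
          refine (card_le_card_of_injOn (fun t' => P t' - 1) (fun t' ht' => ?_) ?_).trans hG
          · exact hm _ (mem_filter.1 ht').2
          · -- a set that is picked has no active elements afterwards and is not picked again
            have aux : ∀ a < t, ∀ b < a, P a ≠ 0 → P b ≠ 0 → P a - 1 = P b - 1 → False := by
              intro a ha b hb h0 h0' hab
              have hpos := (hrun.pick a (by omega) (P a - 1) (by omega)).2.2.1
              obtain ⟨e', -, ha', hm'⟩ := gain_pos_iff.1 hpos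
              exact ha' b hb (P a - 1) (by omega) hm'
            intro a ha b hb hab
            simp only [coe_filter, mem_filter, mem_range, Set.mem_ofPred_eq] at ha hb
            rcases lt_trichotomy a b with h' | h' | h'
            · exact (aux b hb.1.1 a h' hb.1.2 ha.1.2 hab.symm).elim
            · exact h'
            · exact (aux a ha.1.1 b h' ha.1.2 hb.1.2 hab).elim
        · rw [if_neg (not_not.2 h), filter_eq_empty_iff.2, card_empty, zero_mul]
          intro t' ht' hm
          obtain ⟨ht', h0⟩ := mem_filter.1 ht'
          exact h t' (mem_range.1 ht') (P t' - 1) (by omega) hm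
    _ = _ := by rw [← sum_filter, mul_sum]

/-- Weak duality: a solution with `m` sets, each of load at most `W`, bounds the sum of all dual
variables, up to the largest possible dual variable for each of the `#E - k` elements that need not
be covered. -/
lemma sum_dual_le {W t : ℕ} {S : Finset ℕ} (hW : ∀ g, load E mem P t g ≤ W) {F : Finset ε}
    (hFE : F ⊆ E) (hFS : ∀ e ∈ F, ∃ g ∈ S, mem g e) :
    ∑ e ∈ E, dual mem P t e ≤ #S * W + (#E - #F) * pauses P t := by
  classical
  rw [← sum_sdiff hFE, add_comm]
  gcongr
  · calc ∑ e ∈ F, dual mem P t e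
        ≤ ∑ e ∈ F, ∑ g ∈ S, if mem g e then dual mem P t e else 0 := by
          refine sum_le_sum fun e he => ?_
          obtain ⟨g, hg, hm⟩ := hFS e he
          have := single_le_sum_of_canonicallyOrdered
            (f := fun g => if mem g e then dual mem P t e else 0) hg
          rwa [if_pos hm] at this
      _ ≤ ∑ e ∈ E, ∑ g ∈ S, if mem g e then dual mem P t e else 0 := sum_le_sum_of_subset hFE
      _ = ∑ g ∈ S, ∑ e ∈ E with mem g e, dual mem P t e := by
          simp only [sum_filter]
          exact sum_comm
      _ ≤ ∑ g ∈ S, W := sum_le_sum fun g _ => by rw [← load_eq]; exact hW g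
      _ = #S * W := by simp
  · rw [← card_sdiff_of_subset hFE, ← smul_eq_mul]
    exact sum_le_card_nsmul _ _ _ fun e _ => dual_le t e

include hrun hlt hkE in
/-- The primal-dual algorithm picks at most `p` times as many sets as any solution has. Before the
last pick, more than `#E - k` elements are active, and the dual variables of the surplus ones leave a
gap in the weak duality inequality; as the number of sets is an integer, this gap pays for the last
pick. -/
theorem Tight.picks_le {p : ℕ} (hp0 : 0 < p)
    (hp : ∀ e ∈ E, ∃ G : Finset ℕ, #G ≤ p ∧ ∀ g, mem g e → g ∈ G)
    (hex : ∀ e ∈ E, ∃ g, mem g e) (hk : 1 ≤ k) (hB : N + #E < B) {S : Finset ℕ}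
    (hN : #E * #E * #S < N) (hS : ∃ F ⊆ E, k ≤ #F ∧ ∀ e ∈ F, ∃ g ∈ S, mem g e) :
    picks P B ≤ p * #S := by
  classical
  obtain ⟨F, hFE, hF, hFS⟩ := hS
  have hm : 0 < #S := by
    obtain ⟨e, he⟩ := card_pos.1 (hk.trans hF)
    obtain ⟨g, hg, -⟩ := hFS e he
    exact card_pos.2 ⟨g, hg⟩
  have hcov := Tight.covers hrun hlt hkE hex hB
  have hex' : ∃ T, k ≤ covered E mem P T := ⟨B, hcov⟩
  obtain ⟨T, hT⟩ : ∃ T, T = Nat.find hex' := ⟨_, rfl⟩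
  have hTk : k ≤ covered E mem P T := hT ▸ Nat.find_spec hex'
  have hTB : T ≤ B := hT ▸ Nat.find_min' hex' hcov
  have hmin : ∀ t < T, covered E mem P t < k := by
    intro t ht
    by_contra! h
    have := Nat.find_min' hex' h
    omega
  rw [hrun.picks_eq hTB hTk]
  obtain _ | t := T
  · simp [picks]
  have hpt : picks P (t + 1) ≤ picks P t + 1 := by rw [picks_succ]; split_ifs <;> omega
  refine hpt.trans ?_
  by_contra! hcon
  have hlarge : p * #S ≤ picks P t := by omega
  have h₁ := Tight.picks_mul_le hrun hp (t := t) (by omega)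
  have h₂ := sum_dual_le (P := P) (t := t) (Tight.load_le hrun hlt (by omega)
    fun t' ht' => hmin t' (by omega)) hFE hFS
  have h₃ : ∑ e ∈ E with Active mem P t e, dual mem P t e =
      #{e ∈ E | Active mem P t e} * pauses P t := by
    rw [← smul_eq_mul, ← sum_const]
    exact sum_congr rfl fun e he => dual_eq (mem_filter.1 he).2
  have h₄ := sum_filter_add_sum_filter_not E (Active mem P t) (dual mem P t)
  have h₅ := card_active (E := E) (mem := mem) (P := P) t
  have h₆ := hmin t (by omega)
  have h₇ : (#E - #F + 1) * pauses P t ≤ #{e ∈ E | Active mem P t e} * pauses P t :=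
    Nat.mul_le_mul_right _ (by omega)
  have h₈ : ∑ e ∈ E with ¬ Active mem P t e, dual mem P t e + pauses P t ≤ #S * (N + #E) := by
    rw [h₃] at h₄
    rw [add_mul, one_mul] at h₇
    omega
  -- hence the common value of the dual variables of the active elements is small
  have h₉ : pauses P t ≤ #S * #E := by
    have h₁₀ : p * #S * N ≤ picks P t * N := Nat.mul_le_mul_right _ hlarge
    have h₁₁ := Nat.mul_le_mul_left p h₈
    have h₁₂ : p * pauses P t ≤ p * (#S * #E) := by nlinarith
    exact Nat.le_of_mul_le_mul_left h₁₂ hp0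
  -- but the first picked set has load at least `N`
  have hpos : 0 < picks P t := (Nat.mul_pos hp0 hm).trans_le hlarge
  obtain ⟨t', ht'⟩ := card_pos.1 hpos
  obtain ⟨ht', h0⟩ := mem_filter.1 ht'
  have ht' := mem_range.1 ht'
  have hload := (hrun.pick t' (by omega) (P t' - 1) (by omega)).2.2.2
  have : load E mem P t' (P t' - 1) ≤ #E * pauses P t := by
    refine (load_mono _ ht'.le).trans ?_
    dsimp only
    rw [load_eq]
    refine (sum_le_card_nsmul _ _ _ fun e _ => dual_le t e).trans ?_
    rw [smul_eq_mul]
    exact Nat.mul_le_mul_right _ (card_filter_le _ _)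
  have : #E * pauses P t ≤ #E * (#S * #E) := Nat.mul_le_mul_left _ h₉
  have : #E * (#S * #E) = #E * #E * #S := by ring
  omega

end PrimalDual

end Covering

/-! ### Listed databases: encoding, and results as vectors of positions -/

namespace ADP

namespace CQ

variable (Q : CQ) (L : (i : Fin Q.p) → List (Tuple (Q.attrs i)))

/-- The tuple at position `j` in the list of relation `r`, with a junk value outside the list. -/
def tup (r : Fin Q.p) (j : ℕ) : Tuple (Q.attrs r) := (L r).getD j fun _ => 0

/-- The part of the encoding of a database that belongs to relation `r`. -/
def relCode (r : Fin Q.p) : List ℕ := (L r).length :: (L r).flatMap encodeTuple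

/-- The position in the input `k :: Q.encode L` at which the part of relation `r` starts. It is
defined for all numbers `r`, for the sake of recursion. -/
def offset (r : ℕ) : ℕ := 1 + (((List.finRange Q.p).take r).flatMap (relCode Q L)).length

@[simp] lemma length_encodeTuple {B : Finset ℕ} (t : Tuple B) : (encodeTuple t).length = B.card := by
  simp [encodeTuple]

lemma length_flatMap_encodeTuple {B : Finset ℕ} (l : List (Tuple B)) :
    (l.flatMap encodeTuple).length = l.length * B.card := by
  simp [List.length_flatMap]

lemma length_relCode (r : Fin Q.p) :
    (relCode Q L r).length = 1 + (L r).length * (Q.attrs r).card := by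
  rw [relCode, List.length_cons, length_flatMap_encodeTuple, add_comm]

lemma offset_succ (r : Fin Q.p) :
    offset Q L (r + 1) = offset Q L r + 1 + (L r).length * (Q.attrs r).card := by
  have : (List.finRange Q.p).take (r + 1) = (List.finRange Q.p).take r ++ [r] := by
    rw [List.take_add_one]
    simp
  rw [offset, offset, this, List.flatMap_append, List.length_append, List.flatMap_singleton,
    length_relCode]
  ring

lemma getD_relCode (k : ℕ) (r : Fin Q.p) {i : ℕ} (hi : i < (relCode Q L r).length) :
    (k :: Q.encode L).getD (offset Q L r + i) 0 = (relCode Q L r).getD i 0 := by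
  have h : List.finRange Q.p = (List.finRange Q.p).take r ++
      r :: (List.finRange Q.p).drop (r + 1) := by
    conv_lhs => rw [← List.take_append_drop r (List.finRange Q.p)]
    rw [List.drop_eq_getElem_cons (by simp)]
    simp
  have henc : Q.encode L = ((List.finRange Q.p).take r).flatMap (relCode Q L) ++
      (relCode Q L r ++ ((List.finRange Q.p).drop (r + 1)).flatMap (relCode Q L)) := by
    conv_lhs => rw [encode, h]
    rw [List.flatMap_append, List.flatMap_cons]
    rfl
  rw [henc, offset, add_assoc, add_comm 1, List.getD_cons_succ,
    List.getD_append_right _ _ _ _ (by omega), Nat.add_sub_cancel_left, List.getD_append _ _ _ _ hi]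

lemma getD_offset (k : ℕ) (r : Fin Q.p) :
    (k :: Q.encode L).getD (offset Q L r) 0 = (L r).length := by
  have := getD_relCode Q L k r (i := 0) (by simp [relCode])
  simpa [relCode] using this

lemma getD_flatMap_encodeTuple {B : Finset ℕ} (l : List (Tuple B)) {j : ℕ} (hj : j < l.length)
    (q : Fin B.card) : (l.flatMap encodeTuple).getD (j * B.card + q) 0 =
      l.getD j (fun _ => 0) (B.orderIsoOfFin rfl q) := by
  induction l generalizing j with
  | nil => simp at hj
  | cons t l ih =>
    rw [List.flatMap_cons]
    obtain _ | j := j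
    · rw [List.getD_append _ _ _ _ (by simp)]
      simp [encodeTuple]
    · rw [List.getD_append_right _ _ _ _ (by simp; nlinarith), length_encodeTuple]
      have : (j + 1) * B.card + q - B.card = j * B.card + q := by
        rw [add_mul, one_mul]; omega
      rw [this, ih (by simpa using hj)]
      simp

lemma getD_value (k : ℕ) (r : Fin Q.p) {j : ℕ} (hj : j < (L r).length)
    (q : Fin (Q.attrs r).card) :
    (k :: Q.encode L).getD (offset Q L r + 1 + j * (Q.attrs r).card + q) 0 =
      tup Q L r j ((Q.attrs r).orderIsoOfFin rfl q) := by
  have h : j * (Q.attrs r).card + q < (L r).length * (Q.attrs r).card := by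
    have : (j + 1) * (Q.attrs r).card ≤ (L r).length * (Q.attrs r).card :=
      Nat.mul_le_mul_right _ hj
    have := q.2
    rw [add_mul, one_mul] at *
    omega
  have := getD_relCode Q L k r (i := j * (Q.attrs r).card + q + 1)
    (by rw [length_relCode]; omega)
  rw [show offset Q L r + 1 + j * (Q.attrs r).card + q =
    offset Q L r + (j * (Q.attrs r).card + q + 1) by ring, this, relCode, List.getD_cons_succ,
    getD_flatMap_encodeTuple _ hj]
  rfl

lemma length_encode :
    (Q.encode L).length = ∑ r, (1 + (L r).length * (Q.attrs r).card) := by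
  rw [encode, List.length_flatMap, ← List.ofFn_eq_map, List.sum_ofFn]
  exact Finset.sum_congr rfl fun r _ => length_relCode Q L r

variable {Q L}

lemma IsListing.length_eq {D : Q.Database} (h : Q.IsListing D L) (r : Fin Q.p) :
    (L r).length = (D r).card := by
  rw [← (h r).2, List.toFinset_card_of_nodup (h r).1]

lemma IsListing.length_le {D : Q.Database} (h : Q.IsListing D L) (r : Fin Q.p) :
    (L r).length ≤ 1 + (L r).length * (Q.attrs r).card := by
  rcases Nat.eq_zero_or_pos (Q.attrs r).card with h0 | h0
  · have : IsEmpty (Q.attrs r) := by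
      rw [Finset.card_eq_zero] at h0
      rw [h0]
      infer_instance
    have : (D r).card ≤ 1 := Finset.card_le_one_of_subsingleton _
    rw [h.length_eq]
    omega
  · nlinarith

lemma IsListing.size_le {D : Q.Database} (h : Q.IsListing D L) :
    D.size ≤ (Q.encode L).length := by
  rw [length_encode, Database.size]
  exact Finset.sum_le_sum fun r _ => (h.length_eq r).symm.trans_le (h.length_le r)

lemma IsListing.length_le_length {D : Q.Database} (h : Q.IsListing D L) (r : Fin Q.p) :
    (L r).length ≤ (Q.encode L).length := by
  rw [length_encode]
  exact (h.length_le r).trans (Finset.single_le_sum_of_canonicallyOrdered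
    (f := fun r => 1 + (L r).length * (Q.attrs r).card) (Finset.mem_univ r))

lemma IsListing.length_encode_le {D : Q.Database} (h : Q.IsListing D L) :
    (Q.encode L).length ≤ Q.p + (∑ r, (Q.attrs r).card) * D.size := by
  rw [length_encode, Finset.sum_add_distrib, Finset.sum_mul]
  refine add_le_add (by simp) (Finset.sum_le_sum fun r _ => ?_)
  rw [mul_comm, h.length_eq]
  exact Nat.mul_le_mul_left _ (Finset.single_le_sum_of_canonicallyOrdered
    (f := fun r => (D r).card) (Finset.mem_univ r))

lemma p_le_length_encode : Q.p ≤ (Q.encode L).length := by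
  rw [length_encode, Finset.sum_add_distrib]
  simp

lemma IsListing.tup_mem {D : Q.Database} (h : Q.IsListing D L) (r : Fin Q.p) {j : ℕ}
    (hj : j < (L r).length) : tup Q L r j ∈ D r := by
  rw [← (h r).2, List.mem_toFinset, tup, List.getD_eq_getElem _ _ hj]
  exact List.getElem_mem hj

lemma IsListing.tup_inj {D : Q.Database} (h : Q.IsListing D L) {r : Fin Q.p} {j j' : ℕ}
    (hj : j < (L r).length) (hj' : j' < (L r).length) (he : tup Q L r j = tup Q L r j') :
    j = j' := by
  rw [tup, tup, List.getD_eq_getElem _ _ hj, List.getD_eq_getElem _ _ hj'] at he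
  exact (h r).1.getElem_inj_iff.1 he

lemma IsListing.exists_tup {D : Q.Database} (h : Q.IsListing D L) {r : Fin Q.p}
    {t : Tuple (Q.attrs r)} (ht : t ∈ D r) : ∃ j < (L r).length, tup Q L r j = t := by
  rw [← (h r).2, List.mem_toFinset] at ht
  obtain ⟨j, hj, rfl⟩ := List.getElem_of_mem ht
  exact ⟨j, hj, by rw [tup, List.getD_eq_getElem _ _ hj]⟩

variable (Q L)

/-- The vector `e` selects a position in the list of each relation, and the tuples at these positions
agree on their common attributes. -/
def Joins (e : Fin Q.p → ℕ) : Prop :=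
  (∀ r, e r < (L r).length) ∧
    ∀ r r' a, ∀ (h : a ∈ Q.attrs r) (h' : a ∈ Q.attrs r'),
      tup Q L r (e r) ⟨a, h⟩ = tup Q L r' (e r') ⟨a, h'⟩

open Classical in
/-- The natural join, as a set of vectors of positions. -/
noncomputable def positions : Finset (Fin Q.p → ℕ) :=
  {e ∈ Fintype.piFinset fun r => Finset.range (L r).length | Joins Q L e}

variable {Q L}

lemma mem_positions {e : Fin Q.p → ℕ} : e ∈ positions Q L ↔ Joins Q L e := by
  simp only [positions, Finset.mem_filter, Fintype.mem_piFinset, Finset.mem_range]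
  exact ⟨fun h => h.2, fun h => ⟨h.1, h⟩⟩

lemma exists_rel (a : Q.attr) : ∃ r, (a : ℕ) ∈ Q.attrs r := by
  obtain ⟨r, -, h⟩ := Finset.mem_biUnion.1 a.2
  exact ⟨r, h⟩

variable (Q L) in
/-- The result at a vector of positions. -/
noncomputable def glue (e : Fin Q.p → ℕ) : Tuple Q.attr := fun a =>
  tup Q L (exists_rel a).choose (e (exists_rel a).choose) ⟨a, (exists_rel a).choose_spec⟩

lemma restrict_glue {e : Fin Q.p → ℕ} (he : Joins Q L e) (r : Fin Q.p) :
    Tuple.restrict (Q.attrs_subset r) (glue Q L e) = tup Q L r (e r) := by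
  funext ⟨a, ha⟩
  exact he.2 _ _ _ _ _

lemma join_eq {D : Q.Database} (h : Q.IsListing D L) :
    Q.join D = glue Q L '' {e | Joins Q L e} := by
  ext t
  constructor
  · intro ht
    choose e he het using fun r => h.exists_tup (ht r)
    have hJ : Joins Q L e := by
      refine ⟨he, fun r r' a ha ha' => ?_⟩
      rw [het, het]
      rfl
    refine ⟨e, hJ, ?_⟩
    funext a
    obtain ⟨r, hr⟩ := exists_rel a
    exact congrFun ((restrict_glue hJ r).trans (het r)) ⟨a, hr⟩
  · rintro ⟨e, he, rfl⟩ r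
    rw [restrict_glue he]
    exact h.tup_mem r (he.1 r)

lemma glue_injOn {D : Q.Database} (h : Q.IsListing D L) :
    Set.InjOn (glue Q L) {e | Joins Q L e} := by
  intro e he e' he' hee
  funext r
  refine h.tup_inj (he.1 r) (he'.1 r) ?_
  rw [← restrict_glue he, ← restrict_glue he', hee]

/-- The result of a full query is the natural join, up to the names of the types. -/
lemma IsFull.exists_result_eq (hQ : Q.IsFull) : ∃ f : Tuple Q.attr → Tuple Q.head,
    Function.Injective f ∧ ∀ D : Q.Database, Q.result D = f '' Q.join D := by
  refine ⟨Tuple.restrict Q.head_subset, fun t t' h => ?_, fun D => rfl⟩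
  funext ⟨a, ha⟩
  exact congrFun h ⟨a, hQ.symm ▸ ha⟩

lemma ncard_result {D : Q.Database} (hQ : Q.IsFull) (h : Q.IsListing D L) :
    (Q.result D).ncard = (positions Q L).card := by
  obtain ⟨f, hf, hres⟩ := hQ.exists_result_eq
  rw [hres, Set.ncard_image_of_injective _ hf, join_eq h,
    (glue_injOn h).ncard_image, ← Set.ncard_coe_finset]
  congr 1
  ext e
  simp [mem_positions]

open Classical in
/-- The results that are lost if the tuples of `S` are deleted. -/
lemma ncard_result_sdiff {D S : Q.Database} (hQ : Q.IsFull) (h : Q.IsListing D L) :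
    (Q.result D \ Q.result fun i => D i \ S i).ncard =
      {e ∈ positions Q L | ∃ r, tup Q L r (e r) ∈ S r}.card := by
  obtain ⟨f, hf, hres⟩ := hQ.exists_result_eq
  rw [hres, hres, ← Set.image_sdiff hf, Set.ncard_image_of_injective _ hf, ← Set.ncard_coe_finset,
    ← ((glue_injOn h).mono (s₁ := _) fun e he => ?_).ncard_image]
  · congr 1
    ext t
    simp only [join_eq h, Set.mem_sdiff, Set.mem_image, Finset.coe_filter, mem_positions,
      Set.mem_ofPred_eq]
    constructor
    · rintro ⟨⟨e, he, rfl⟩, ht⟩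
      refine ⟨e, ⟨he, ?_⟩, rfl⟩
      by_contra! hS
      refine ht fun r => ?_
      rw [restrict_glue he]
      exact Finset.mem_sdiff.2 ⟨h.tup_mem r (he.1 r), hS r⟩
    · rintro ⟨e, ⟨he, r, hr⟩, rfl⟩
      refine ⟨⟨e, he, rfl⟩, fun ht => ?_⟩
      have := ht r
      rw [restrict_glue he] at this
      exact (Finset.mem_sdiff.1 this).2 hr
  · exact mem_positions.1 (Finset.mem_filter.1 he).1

/-! ### Input tuples as sets of results -/

variable (Q) in
/-- The input tuples are numbered: number `j * Q.p + r` is the tuple at position `j` of relation `r`.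
The predicate says that the result at the vector of positions `e` comes from tuple number `g`. -/
def Uses (g : ℕ) (e : Fin Q.p → ℕ) : Prop := ∃ r, e r * Q.p + r = g

lemma number_inj {j j' : ℕ} {r r' : Fin Q.p} (h : j * Q.p + r = j' * Q.p + r') :
    j = j' ∧ r = r' := by
  have h₁ := congrArg (· % Q.p) h
  have h₂ := congrArg (· / Q.p) h
  simp only [add_comm (_ * Q.p), Nat.add_mul_mod_self_right, Nat.mod_eq_of_lt r.2,
    Nat.mod_eq_of_lt r'.2] at h₁
  simp only [add_comm (_ * Q.p), Nat.add_mul_div_right _ _ Q.p_pos, Nat.div_eq_of_lt r.2,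
    Nat.div_eq_of_lt r'.2, zero_add] at h₂
  exact ⟨h₂, Fin.ext h₁⟩

lemma exists_uses (e : Fin Q.p → ℕ) : ∃ g, Uses Q g e := ⟨_, ⟨0, Q.p_pos⟩, rfl⟩

/-- In a full query, each result comes from exactly one tuple of each relation. -/
lemma exists_finset_uses (e : Fin Q.p → ℕ) :
    ∃ G : Finset ℕ, G.card ≤ Q.p ∧ ∀ g, Uses Q g e → g ∈ G := by
  refine ⟨Finset.univ.image fun r : Fin Q.p => e r * Q.p + r,
    Finset.card_image_le.trans (by simp), ?_⟩
  rintro _ ⟨r, rfl⟩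
  exact Finset.mem_image_of_mem _ (Finset.mem_univ r)

variable (Q L) in
/-- The list of the tuples of relation `r` with a number in `G`. -/
def select (G : Finset ℕ) (r : Fin Q.p) : List (Tuple (Q.attrs r)) :=
  ((List.range (L r).length).filter fun j => j * Q.p + r ∈ G).map (tup Q L r)

variable (Q L) in
/-- The set of the tuples with a number in `G`. -/
noncomputable def selected (G : Finset ℕ) : Q.Database := fun r => (select Q L G r).toFinset

lemma mem_selected {G : Finset ℕ} {r : Fin Q.p} {t : Tuple (Q.attrs r)} :
    t ∈ selected Q L G r ↔ ∃ j < (L r).length, j * Q.p + r ∈ G ∧ tup Q L r j = t := by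
  simp [selected, select, and_assoc]

lemma isListing_selected {D : Q.Database} (h : Q.IsListing D L) (G : Finset ℕ) :
    Q.IsListing (selected Q L G) (select Q L G) := by
  refine fun r => ⟨?_, rfl⟩
  refine List.Nodup.map_on (fun j hj j' hj' he => ?_) (List.nodup_range.filter _)
  simp only [List.mem_filter, List.mem_range] at hj hj'
  exact h.tup_inj hj.1 hj'.1 he

lemma size_selected_le (G : Finset ℕ) :
    (selected Q L G).size ≤ G.card := by
  have h₁ : ∀ r, (selected Q L G r).card ≤
      ((Finset.range (L r).length).filter fun j => j * Q.p + r ∈ G).card := by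
    intro r
    refine (Finset.card_le_card fun t ht => ?_).trans
      (Finset.card_image_le (f := tup Q L r))
    obtain ⟨j, hj, hG, rfl⟩ := mem_selected.1 ht
    exact Finset.mem_image_of_mem _ (by simp [hj, hG])
  refine (Finset.sum_le_sum fun r _ => h₁ r).trans ?_
  rw [← Finset.card_sigma]
  refine Finset.card_le_card_of_injOn (fun x => x.2 * Q.p + x.1) (fun x hx => ?_) ?_
  · exact (Finset.mem_filter.1 (Finset.mem_sigma.1 hx).2).2
  · rintro ⟨r, j⟩ - ⟨r', j'⟩ - he
    obtain ⟨rfl, rfl⟩ := number_inj he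
    rfl

lemma isSolution_selected {D : Q.Database} (hQ : Q.IsFull) (h : Q.IsListing D L) {G : Finset ℕ}
    {k : ℕ} {F : Finset (Fin Q.p → ℕ)} (hF : F ⊆ positions Q L) (hk : k ≤ F.card)
    (hG : ∀ e ∈ F, ∃ g ∈ G, Uses Q g e) : Q.IsSolution D k (selected Q L G) := by
  classical
  refine ⟨fun r t ht => ?_, ?_⟩
  · obtain ⟨j, hj, -, rfl⟩ := mem_selected.1 ht
    exact h.tup_mem r hj
  · rw [ncard_result_sdiff hQ h]
    refine hk.trans (Finset.card_le_card fun e he => Finset.mem_filter.2 ⟨hF he, ?_⟩)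
    obtain ⟨_, hg, r, rfl⟩ := hG e he
    exact ⟨r, mem_selected.2 ⟨_, (mem_positions.1 (hF he)).1 r, hg, rfl⟩⟩

lemma IsSolution.exists_finset {D S : Q.Database} (hQ : Q.IsFull) (h : Q.IsListing D L) {k : ℕ}
    (hS : Q.IsSolution D k S) : ∃ G : Finset ℕ, G.card ≤ S.size ∧
      ∃ F ⊆ positions Q L, k ≤ F.card ∧ ∀ e ∈ F, ∃ g ∈ G, Uses Q g e := by
  classical
  refine ⟨Finset.univ.biUnion fun r => ((Finset.range (L r).length).filter fun j =>
    tup Q L r j ∈ S r).image fun j => j * Q.p + r, ?_, _, Finset.filter_subset _ _,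
    hS.2.trans_eq (ncard_result_sdiff hQ h), ?_⟩
  · refine Finset.card_biUnion_le.trans (Finset.sum_le_sum fun r _ =>
      Finset.card_image_le.trans ?_)
    refine Finset.card_le_card_of_injOn (tup Q L r) (fun j hj => (Finset.mem_filter.1 hj).2) ?_
    intro j hj j' hj' he
    simp only [Finset.coe_filter, Finset.mem_range, Set.mem_ofPred_eq] at hj hj'
    exact h.tup_inj hj.1 hj'.1 he
  · intro e he
    obtain ⟨he, r, hr⟩ := Finset.mem_filter.1 he
    exact ⟨_, Finset.mem_biUnion.2 ⟨r, Finset.mem_univ r, Finset.mem_image_of_mem _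
      (Finset.mem_filter.2 ⟨Finset.mem_range.2 ((mem_positions.1 he).1 r), hr⟩)⟩, r, rfl⟩

lemma card_positions_le {b : ℕ} (hb : ∀ r, (L r).length ≤ b) : (positions Q L).card ≤ b ^ Q.p := by
  classical
  refine (Finset.card_filter_le _ _).trans ?_
  rw [Fintype.card_piFinset]
  refine (Finset.prod_le_prod' (fun r _ => (Finset.card_range _).trans_le (hb r))).trans ?_
  simp

end CQ

end ADP

/-! ### Expressions for the quantities of the covering algorithms -/

namespace RAM.LExp

/-- An expression as a condition: it holds if the value is nonzero. -/
def Holds (B : ℕ) (A : ℕ → ℕ → ℕ) (e : LExp) (ρ : ℕ → ℕ) : Prop := e.eval B A ρ ≠ 0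

instance (B : ℕ) (A : ℕ → ℕ → ℕ) (e : LExp) (ρ : ℕ → ℕ) : Decidable (Holds B A e ρ) :=
  inferInstanceAs (Decidable (_ ≠ _))

/-- `e < f` -/
def lt (e f : LExp) : LExp := .sub f e

/-- `e ≤ f` -/
def le (e f : LExp) : LExp := .sub (.const 1) (.sub e f)

/-- Negation. -/
def not (e : LExp) : LExp := .sub (.const 1) e

/-- `e = f` -/
def eq (e f : LExp) : LExp := not (.add (.sub e f) (.sub f e))

/-- Conjunction. -/
def and (e f : LExp) : LExp := .ite e f (.const 0)

/-- Disjunction of a list of conditions. -/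
def any : List LExp → LExp
  | [] => .const 0
  | e :: l => .add e (any l)

/-- Conjunction of a list of conditions. -/
def all : List LExp → LExp
  | [] => .const 1
  | e :: l => and e (all l)

/-- `n * e` for a constant `n`. -/
def scale : ℕ → LExp → LExp
  | 0, _ => .const 0
  | n + 1, e => .add (scale n e) e

/-- The power `B ^ n` of the bound of the sums, as a nested sum of ones; the name of the summation
variable is immaterial. -/
def pow : ℕ → LExp
  | 0 => .const 1
  | n + 1 => .sum 5 (pow n)

variable {B : ℕ} {A : ℕ → ℕ → ℕ} {ρ : ℕ → ℕ}

@[simp] lemma eval_const (n : ℕ) : (const n).eval B A ρ = n := rfl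

@[simp] lemma eval_var (x : ℕ) : (var x).eval B A ρ = ρ x := rfl

@[simp] lemma eval_arr (a : ℕ) (i : LExp) : (arr a i).eval B A ρ = A a (i.eval B A ρ) := rfl

@[simp] lemma eval_add (e f : LExp) :
    (add e f).eval B A ρ = e.eval B A ρ + f.eval B A ρ := rfl

lemma eval_sum (x : ℕ) (e : LExp) : (sum x e).eval B A ρ =
    ∑ i ∈ Finset.range B, e.eval B A (Function.update ρ x i) := rfl

@[simp] lemma holds_lt {e f : LExp} : Holds B A (lt e f) ρ ↔ e.eval B A ρ < f.eval B A ρ := by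
  simp [Holds, lt, eval, Nat.sub_eq_zero_iff_le]

@[simp] lemma holds_le {e f : LExp} : Holds B A (le e f) ρ ↔ e.eval B A ρ ≤ f.eval B A ρ := by
  simp only [Holds, le, eval]; omega

@[simp] lemma holds_not {e : LExp} : Holds B A (not e) ρ ↔ ¬ Holds B A e ρ := by
  simp only [Holds, not, eval]; omega

lemma eval_not (e : LExp) : (not e).eval B A ρ = if Holds B A e ρ then 0 else 1 := by
  by_cases h : e.eval B A ρ = 0
  · simp [Holds, not, eval, h]
  · rw [if_pos (show Holds B A e ρ from h)]
    simp only [not, eval]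
    omega

@[simp] lemma holds_eq {e f : LExp} : Holds B A (eq e f) ρ ↔ e.eval B A ρ = f.eval B A ρ := by
  simp only [Holds, eq, not, eval]; omega

@[simp] lemma eval_ite (c e f : LExp) : (ite c e f).eval B A ρ =
    if Holds B A c ρ then e.eval B A ρ else f.eval B A ρ := by
  by_cases h : c.eval B A ρ = 0 <;> simp [Holds, eval, h]

@[simp] lemma holds_and {e f : LExp} : Holds B A (and e f) ρ ↔ Holds B A e ρ ∧ Holds B A f ρ := by
  simp only [Holds, and, eval]; split_ifs <;> simp_all

@[simp] lemma holds_sum {x : ℕ} {e : LExp} :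
    Holds B A (sum x e) ρ ↔ ∃ i < B, Holds B A e (Function.update ρ x i) := by
  simp [Holds, eval]

@[simp] lemma holds_any {ι : Type*} {l : List ι} {f : ι → LExp} :
    Holds B A (any (l.map f)) ρ ↔ ∃ i ∈ l, Holds B A (f i) ρ := by
  induction l with
  | nil => simp [any, Holds]
  | cons i l ih =>
    simp only [List.mem_cons, exists_eq_or_imp, ← ih]
    simp only [List.map_cons, any, Holds, eval]
    omega

@[simp] lemma holds_all {ι : Type*} {l : List ι} {f : ι → LExp} :
    Holds B A (all (l.map f)) ρ ↔ ∀ i ∈ l, Holds B A (f i) ρ := by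
  induction l with
  | nil => simp [all, Holds]
  | cons i l ih => simp [all, ih]

lemma holds_arr {a : ℕ} {i : LExp} : Holds B A (arr a i) ρ ↔ A a (i.eval B A ρ) ≠ 0 := Iff.rfl

@[simp] lemma eval_scale (n : ℕ) (e : LExp) : (scale n e).eval B A ρ = e.eval B A ρ * n := by
  induction n with
  | zero => rfl
  | succ n ih => simp only [scale, eval, ih]; ring

@[simp] lemma eval_pow (n : ℕ) : (pow n).eval B A ρ = B ^ n := by
  induction n generalizing ρ with
  | zero => rfl
  | succ n ih => simp [pow, eval, ih, pow_succ']

/-- The `m`-fold sum over the variables `10, …, 10 + m - 1`. -/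
def nest : ℕ → LExp → LExp
  | 0, e => e
  | m + 1, e => .sum (10 + m) (nest m e)

/-- The environment in which variable `10 + r` has the value `v r`. -/
def bind {m : ℕ} (ρ : ℕ → ℕ) (v : Fin m → ℕ) (y : ℕ) : ℕ :=
  if h : 10 ≤ y ∧ y - 10 < m then v ⟨y - 10, h.2⟩ else ρ y

@[simp] lemma bind_add {m : ℕ} (v : Fin m → ℕ) (r : Fin m) : bind ρ v (10 + r) = v r := by
  simp [bind]

lemma bind_of_lt {m : ℕ} (v : Fin m → ℕ) {y : ℕ} (hy : y < 10) : bind ρ v y = ρ y := by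
  rw [bind, dif_neg (by omega)]

lemma bind_snoc {m : ℕ} (v : Fin m → ℕ) (i : ℕ) :
    bind ρ (Fin.snoc v i : Fin (m + 1) → ℕ) = bind (Function.update ρ (10 + m) i) v := by
  funext y
  by_cases h : 10 ≤ y ∧ y - 10 < m
  · rw [bind, bind, dif_pos h, dif_pos ⟨h.1, by omega⟩, Fin.snoc, dif_pos h.2]
    rfl
  · rw [bind, bind, dif_neg h]
    rcases eq_or_ne y (10 + m) with rfl | hy
    · simp [Fin.snoc]
    · rw [dif_neg (by omega), Function.update_of_ne hy]

lemma eval_nest (m : ℕ) (e : LExp) : (nest m e).eval B A ρ =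
    ∑ v ∈ Fintype.piFinset fun _ : Fin m => Finset.range B, e.eval B A (bind ρ v) := by
  induction m generalizing ρ with
  | zero =>
    have h : ∀ v : Fin 0 → ℕ, bind ρ v = ρ := fun v => by
      funext y
      rw [bind, dif_neg (by omega)]
    simp [nest, h]
  | succ m ih =>
    simp only [nest, eval, ih]
    rw [← Finset.sum_product']
    refine Finset.sum_bij' (fun x _ => (Fin.snoc x.2 x.1 : Fin (m + 1) → ℕ))
      (fun v _ => (v (Fin.last m), Fin.init v)) ?_ ?_ ?_ ?_ ?_
    · rintro ⟨i, v⟩ h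
      simp only [Finset.mem_product, Finset.mem_range, Fintype.mem_piFinset] at h ⊢
      intro r
      induction r using Fin.lastCases with
      | last => simpa using h.1
      | cast r => simpa using h.2 r
    · intro v h
      simp only [Finset.mem_product, Finset.mem_range, Fintype.mem_piFinset] at h ⊢
      exact ⟨h _, fun r => h _⟩
    · rintro ⟨i, v⟩ -
      simp
    · intro v _
      simp
    · rintro ⟨i, v⟩ -
      rw [bind_snoc]

end RAM.LExp

namespace ADP.CQ

open RAM LExp Covering

variable (Q : CQ)

/-! The variables of these expressions, and of the programs below: `0` is the length of the input, `1`
that of the output, `2` the bound of the sums, `3` the step of the covering algorithm or, when the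
output is written, a position in a relation, `4` the scaling factor of the dual variables, `5`, `6`
and `9` are numbers of input tuples, `7` and `8` steps of the covering algorithm, and `10 + r` is a
position in relation `r`. Array `2` holds the run of the covering algorithm. -/

/-- The position in the input at which the part of relation `r` starts. -/
noncomputable def offsetExp : ℕ → LExp
  | 0 => .const 1
  | r + 1 => if h : r < Q.p then
      .add (.add (offsetExp r) (.const 1)) (scale (Q.attrs ⟨r, h⟩).card (.arr 0 (offsetExp r)))
    else .const 0

/-- The number of tuples of relation `r`. -/
noncomputable def lengthExp (r : ℕ) : LExp := .arr 0 (offsetExp Q r)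

/-- The value number `q` of the tuple at position `e` of relation `r`. -/
noncomputable def valueExp (r : Fin Q.p) (e : LExp) (q : ℕ) : LExp :=
  .arr 0 (.add (.add (.add (offsetExp Q r) (.const 1)) (scale (Q.attrs r).card e)) (.const q))

/-- The variables `10 + r` form a vector of positions of joining tuples. -/
noncomputable def joinsExp : LExp :=
  .and (all ((List.finRange Q.p).map fun r : Fin Q.p => lt (.var (10 + r)) (lengthExp Q r)))
    (all ((List.finRange Q.p).map fun r => all ((List.finRange Q.p).map fun r' =>
      all ((Q.attrs r ∩ Q.attrs r').attach.toList.map fun a : ↥(Q.attrs r ∩ Q.attrs r') =>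
        eq (valueExp Q r (.var (10 + r)) (((Q.attrs r).orderIsoOfFin rfl).symm
            ⟨a, Finset.mem_of_mem_inter_left a.2⟩))
          (valueExp Q r' (.var (10 + r')) (((Q.attrs r').orderIsoOfFin rfl).symm
            ⟨a, Finset.mem_of_mem_inter_right a.2⟩))))))

/-- The number of vectors of positions of joining tuples with the property `c`. -/
noncomputable def countExp (c : LExp) : LExp :=
  nest Q.p (.ite (.and (joinsExp Q) c) (.const 1) (.const 0))

/-- The number of the tuple at position `e` of relation `r`. -/
def numberExp (r : Fin Q.p) (e : LExp) : LExp := .add (scale Q.p e) (.const r)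

/-- The result at the current vector of positions uses tuple number `g`. -/
def usesExp (g : ℕ) : LExp :=
  any ((List.finRange Q.p).map fun r => eq (numberExp Q r (.var (10 + r))) (.var g))

/-- The result at the current vector of positions is active at time `t`. -/
def activeExp (t : ℕ) : LExp :=
  .not (.sum 8 (.and (lt (.var 8) (.var t)) (any ((List.finRange Q.p).map fun r =>
    eq (.arr 2 (.var 8)) (.add (numberExp Q r (.var (10 + r))) (.const 1))))))

/-- The gain of tuple number `g` at time `t`; see `Covering.gain`. -/
noncomputable def gainExp (t g : ℕ) : LExp := countExp Q (.and (activeExp Q t) (usesExp Q g))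

/-- The number of covered results at time `t`; see `Covering.covered`. -/
noncomputable def coveredExp (t : ℕ) : LExp := countExp Q (.not (activeExp Q t))

/-- The load of tuple number `g` at time `t`; see `Covering.load`. -/
noncomputable def loadExp (t g : ℕ) : LExp :=
  .sum 7 (.ite (.and (lt (.var 7) (.var t)) (.not (.arr 2 (.var 7)))) (gainExp Q 7 g) (.const 0))

/-- The greedy rule `Covering.Greedy` for tuple number `5` at time `3` (both are variables). -/
noncomputable def greedyExp : LExp := .not (.sum 6 (lt (gainExp Q 3 5) (gainExp Q 3 6)))

/-- The primal-dual rule `Covering.Tight` for tuple number `5` at time `3` (both are variables). -/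
noncomputable def tightExp : LExp := .and (gainExp Q 3 5) (le (.var 4) (loadExp Q 3 5))

/-- The next entry of the run: the least good number, plus one, or `0` if there is no good number or
if nothing is left to do. The least good number is computed as the number of those numbers `x` that
have no good number below or equal to `x`. -/
noncomputable def pickExp (good : LExp) : LExp :=
  .ite (le (.arr 0 (.const 0)) (coveredExp Q 3)) (.const 0) (.ite (.sum 5 good)
    (.add (.sum 9 (.not (.sum 5 (.and (le (.var 5) (.var 9)) good)))) (.const 1)) (.const 0))

variable {Q} {L : (i : Fin Q.p) → List (Tuple (Q.attrs i))} {k B : ℕ} {A : ℕ → ℕ → ℕ} {ρ : ℕ → ℕ}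

variable (Q L k A) in
/-- Array `0` holds the input. -/
def HasInput : Prop := ∀ i, A 0 i = (k :: Q.encode L).getD i 0

lemma eval_offsetExp (hA : HasInput Q L k A) {r : ℕ} (hr : r ≤ Q.p) :
    (offsetExp Q r).eval B A ρ = offset Q L r := by
  induction r with
  | zero => simp [offsetExp, offset]
  | succ r ih =>
    have := offset_succ Q L ⟨r, hr⟩
    simp only at this
    have h := getD_offset Q L k ⟨r, hr⟩
    simp only at h
    rw [offsetExp, dif_pos (by omega), this]
    simp only [eval_const, eval_arr, eval_add, eval_scale, ih (by omega), hA _]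
    rw [h]

lemma eval_lengthExp (hA : HasInput Q L k A) (r : Fin Q.p) :
    (lengthExp Q r).eval B A ρ = (L r).length := by
  rw [lengthExp, eval_arr, eval_offsetExp hA r.2.le, hA, getD_offset]

lemma eval_valueExp (hA : HasInput Q L k A) (r : Fin Q.p) {e : LExp}
    (he : e.eval B A ρ < (L r).length) (q : Fin (Q.attrs r).card) :
    (valueExp Q r e q).eval B A ρ =
      tup Q L r (e.eval B A ρ) ((Q.attrs r).orderIsoOfFin rfl q) := by
  simp only [valueExp, eval_const, eval_arr, eval_add, eval_offsetExp hA r.2.le, eval_scale, hA _]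
  rw [getD_value Q L k r he]

lemma holds_joinsExp (hA : HasInput Q L k A) :
    Holds B A (joinsExp Q) ρ ↔ Joins Q L fun r => ρ (10 + r) := by
  simp only [joinsExp, holds_and, holds_all, holds_lt, holds_eq, eval_lengthExp hA, Joins,
    List.mem_finRange, true_imp_iff]
  refine and_congr_right fun h => ?_
  have hv : ∀ r : Fin Q.p, ∀ q, (valueExp Q r (.var (10 + r)) (q : Fin _)).eval B A ρ = _ :=
    fun r q => eval_valueExp hA r (h r) q
  simp only [hv, OrderIso.apply_symm_apply, Finset.mem_toList, Finset.mem_attach, true_imp_iff,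
    eval_var]
  exact ⟨fun H r r' a ha ha' => H r r' ⟨a, Finset.mem_inter.2 ⟨ha, ha'⟩⟩,
    fun H r r' a => H r r' a _ _⟩

lemma eval_countExp (hA : HasInput Q L k A) (hB : ∀ r, (L r).length ≤ B) {c : LExp}
    {φ : (Fin Q.p → ℕ) → Prop} [DecidablePred φ] (hc : ∀ v, Holds B A c (bind ρ v) ↔ φ v) :
    (countExp Q c).eval B A ρ = ((positions Q L).filter φ).card := by
  rw [countExp, eval_nest]
  simp only [eval_ite, eval_const]
  rw [← Finset.card_filter]
  congr 1
  ext v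
  simp only [holds_and, holds_joinsExp hA, bind_add, hc, Finset.mem_filter, mem_positions,
    Fintype.mem_piFinset, Finset.mem_range]
  exact ⟨fun h => h.2, fun h => ⟨fun r => (h.1.1 r).trans_le (hB r), h⟩⟩

lemma holds_usesExp {g : ℕ} :
    Holds B A (usesExp Q g) ρ ↔ Uses Q (ρ g) fun r => ρ (10 + r) := by
  simp [usesExp, Uses, numberExp]

lemma holds_activeExp {t : ℕ} (ht : t < 8) (hB : ρ t ≤ B) :
    Holds B A (activeExp Q t) ρ ↔ Active (Uses Q) (A 2) (ρ t) fun r => ρ (10 + r) := by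
  have h10 : ∀ r i, Function.update ρ 8 i (10 + r) = ρ (10 + r) := fun r i =>
    Function.update_of_ne (by omega) _ _
  have h8 : ∀ i, Function.update ρ 8 i t = ρ t := fun i => Function.update_of_ne (by omega) _ _
  simp only [activeExp, numberExp, holds_not, holds_sum, holds_and, holds_lt, holds_any, holds_eq,
    eval_const, eval_var, eval_arr, eval_add, eval_scale, Function.update_self, h10, h8, List.mem_finRange, true_and, Active, Uses]
  constructor
  · rintro h t' ht' g hg ⟨r, rfl⟩
    exact h ⟨t', by omega, ht', r, hg⟩
  · rintro h ⟨t', -, ht', r, hr⟩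
    exact h t' ht' _ hr ⟨r, rfl⟩

lemma eval_gainExp (hA : HasInput Q L k A) (hB : ∀ r, (L r).length ≤ B) {t g : ℕ} (ht : t < 8)
    (hg : g < 8) (htB : ρ t ≤ B) :
    (gainExp Q t g).eval B A ρ = gain (positions Q L) (Uses Q) (A 2) (ρ t) (ρ g) := by
  classical
  rw [gainExp, gain]
  refine eval_countExp hA hB fun v => ?_
  rw [holds_and, holds_usesExp, holds_activeExp ht (by rwa [bind_of_lt _ (by omega)])]
  simp only [bind_add, bind_of_lt v (by omega : t < 10), bind_of_lt v (by omega : g < 10)]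

lemma eval_coveredExp (hA : HasInput Q L k A) (hB : ∀ r, (L r).length ≤ B) {t : ℕ} (ht : t < 8)
    (htB : ρ t ≤ B) :
    (coveredExp Q t).eval B A ρ = covered (positions Q L) (Uses Q) (A 2) (ρ t) := by
  classical
  rw [coveredExp, covered]
  refine eval_countExp hA hB fun v => ?_
  rw [holds_not, holds_activeExp ht (by rwa [bind_of_lt _ (by omega)])]
  simp only [bind_add, bind_of_lt v (by omega : t < 10)]

lemma eval_loadExp (hA : HasInput Q L k A) (hB : ∀ r, (L r).length ≤ B) {t g : ℕ} (ht : t < 7)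
    (hg : g < 7) (htB : ρ t ≤ B) :
    (loadExp Q t g).eval B A ρ = load (positions Q L) (Uses Q) (A 2) (ρ t) (ρ g) := by
  have ht' : ∀ i, Function.update ρ 7 i t = ρ t := fun i => Function.update_of_ne (by omega) _ _
  have hg' : ∀ i, Function.update ρ 7 i g = ρ g := fun i => Function.update_of_ne (by omega) _ _
  rw [loadExp, eval_sum, load, ← Finset.sum_subset (Finset.range_mono htB), Finset.sum_filter]
  · refine Finset.sum_congr rfl fun i hi => ?_
    have hi := Finset.mem_range.1 hi
    rw [eval_ite, eval_gainExp hA hB (by omega) (by omega) (by simp; omega)]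
    simp [hg', ht', hi, holds_arr]
  · intro i _ hi
    rw [eval_ite, if_neg]
    · rfl
    · simp only [holds_and, holds_lt, eval_var, Function.update_self, ht']
      exact fun h => hi (Finset.mem_range.2 h.1)

lemma holds_greedyExp (hA : HasInput Q L k A) (hB : ∀ r, (L r).length ≤ B) (htB : ρ 3 ≤ B) :
    Holds B A (greedyExp Q) ρ ↔ Greedy (positions Q L) (Uses Q) (A 2) B (ρ 3) (ρ 5) := by
  have h : ∀ i, ∀ g < 8, (gainExp Q 3 g).eval B A (Function.update ρ 6 i) = _ := fun i g hg =>
    eval_gainExp hA hB (by omega) hg (by simpa)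
  simp [greedyExp, h, Greedy]

lemma holds_tightExp (hA : HasInput Q L k A) (hB : ∀ r, (L r).length ≤ B) (htB : ρ 3 ≤ B) :
    Holds B A (tightExp Q) ρ ↔ Tight (positions Q L) (Uses Q) (A 2) (ρ 4) (ρ 3) (ρ 5) := by
  rw [tightExp, holds_and, holds_le, eval_loadExp hA hB (by omega) (by omega) htB, Holds,
    eval_gainExp hA hB (by omega) (by omega) htB, Tight, eval_var, Nat.pos_iff_ne_zero]

lemma sum_eq_find {φ : ℕ → Prop} [DecidablePred φ] (h : ∃ g, φ g) (hB : Nat.find h < B) :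
    ∑ x ∈ Finset.range B, (if ∃ g < B, g ≤ x ∧ φ g then 0 else 1) = Nat.find h := by
  have : ∀ x < B, (∃ g < B, g ≤ x ∧ φ g) ↔ Nat.find h ≤ x := fun x hx =>
    ⟨fun ⟨g, _, hg, hφ⟩ => (Nat.find_min' h hφ).trans hg, fun hx' => ⟨_, hB, hx', Nat.find_spec h⟩⟩
  rw [Finset.sum_congr rfl fun x hx => if_congr (this x (Finset.mem_range.1 hx)) rfl rfl,
    ← Finset.sum_subset (Finset.range_mono hB.le), Finset.sum_congr rfl fun x hx =>
      if_neg (not_le.2 (Finset.mem_range.1 hx))]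
  · simp
  · intro x _ hx
    rw [if_pos]
    simpa using hx

/-- What `pickExp` computes: the entry `v` at time `t` of a run with the rule `good`. -/
lemma eval_pickExp (hA : HasInput Q L k A) (hB : ∀ r, (L r).length ≤ B) (htB : ρ 3 ≤ B)
    {good : LExp} {φ : ℕ → Prop}
    (hgood : ∀ ρ', (∀ y < 5, ρ' y = ρ y) → (Holds B A good ρ' ↔ φ (ρ' 5))) {v : ℕ}
    (hv : v = (pickExp Q good).eval B A ρ) :
    (∀ g, v = g + 1 → covered (positions Q L) (Uses Q) (A 2) (ρ 3) < k ∧ g < B ∧ φ g) ∧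
      (v = 0 → covered (positions Q L) (Uses Q) (A 2) (ρ 3) < k → ∀ g < B, ¬ φ g) := by
  classical
  have h5 : ∀ i, Holds B A good (Function.update ρ 5 i) ↔ φ i := fun i => by
    rw [hgood _ fun y hy => Function.update_of_ne (by omega) _ _]
    simp
  have h59 : ∀ x i, Holds B A good (Function.update (Function.update ρ 9 x) 5 i) ↔ φ i :=
    fun x i => by
      rw [hgood _ fun y hy => by
        rw [Function.update_of_ne (by omega), Function.update_of_ne (by omega)]]
      simp
  have hk : A 0 0 = k := by rw [hA]; rfl
  simp only [pickExp, eval_ite, holds_le, eval_const, eval_var, eval_arr, eval_add, eval_sum, hk, eval_coveredExp hA hB (by omega) htB,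
    holds_sum, h5, eval_not, holds_and, h59, Function.update_self,
    Function.update_of_ne (by omega : (9 : ℕ) ≠ 5)] at hv
  split_ifs at hv with h₁ h₂
  · exact ⟨fun g hg => by omega, fun _ h => absurd h₁ (not_le.2 h)⟩
  · obtain ⟨g, hg, hφ⟩ := h₂
    have hfind : Nat.find ⟨g, hφ⟩ < B := (Nat.find_min' _ hφ).trans_lt hg
    rw [sum_eq_find ⟨g, hφ⟩ hfind] at hv
    refine ⟨fun g' hg' => ?_, fun h => by omega⟩
    obtain rfl : g' = Nat.find ⟨g, hφ⟩ := by omega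
    exact ⟨by omega, hfind, Nat.find_spec ⟨g, hφ⟩⟩
  · exact ⟨fun g' hg' => by omega, fun _ _ g hg hφ => h₂ ⟨g, hg, hφ⟩⟩

end ADP.CQ

/-! ### Sequences of statements and output -/

namespace RAM

lemma State.val_def (s : State) (e : LExp) : s.val e = e.eval (s.reg 2) s.arr s.env := rfl

/-- Execute the programs of a list one after the other. -/
def seqAll : List Program → Program
  | [] => .skip
  | c :: l => .seq c (seqAll l)

/-- The running time of `seqAll`. -/
noncomputable def seqTime : List (Polynomial ℕ) → Polynomial ℕ
  | [] => 1
  | b :: l => b + seqTime l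

lemma Runs.seqAll {ι : Type*} {c : ι → Program} {b : ι → Polynomial ℕ} {B : ℕ}
    (Inv : List ι → State → Prop) (l : List ι)
    (h : ∀ i ∈ l, ∀ l' s, Inv l' s → Runs (c i) s ((b i).eval B) (Inv (l' ++ [i]))) {s : State}
    (h0 : Inv [] s) : Runs (seqAll (l.map c)) s ((seqTime (l.map b)).eval B) (Inv l) := by
  have key : ∀ l₂ : List ι, (∀ i ∈ l₂, i ∈ l) → ∀ l₁ s, Inv l₁ s →
      Runs (RAM.seqAll (l₂.map c)) s ((seqTime (l₂.map b)).eval B) (Inv (l₁ ++ l₂)) := by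
    intro l₂
    induction l₂ with
    | nil =>
      intro _ l₁ s hs
      refine (Runs.skip hs).weaken (by simp [seqTime]) (by simp)
    | cons i l₂ ih =>
      intro hl l₁ s hs
      refine ((h i (hl i (by simp)) l₁ s hs).seq fun s' hs' =>
        ih (fun j hj => hl j (by simp [hj])) _ s' hs').weaken (by simp [seqTime]) (by simp)
  exact key l (fun _ h => h) [] s h0

lemma runs_when {e : LExp} {c : Program} {s : State} {b : ℕ} {P : State → Prop}
    (h : s.val e ≠ 0 → ∀ s', s'.Same s → Runs c s' b P)
    (h' : s.val e = 0 → ∀ s', s'.Same s → P s') :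
    Runs (when e c) s (e.time.eval (s.reg 2) + (b + 3)) P := by
  refine (runs_compute le_rfl e s).seq ?_
  rintro s₁ ⟨h₁, h₂, -⟩
  refine (Runs.ite (e := .reg 5) (b := b) (b' := 1) (fun h0 => h (by rwa [← h₂]) s₁ h₁)
    fun h0 => Runs.skip (h' (by rwa [← h₂]) s₁ h₁)).weaken ?_ fun _ h => h
  simp only [Exp.cost]
  omega

/-- The memory `s'` arises from `s` by appending `out` to the output; the input, the run of the
covering algorithm and the bound of the sums are kept. -/
structure Appends (s s' : State) (out : List ℕ) : Prop where
  input : s'.arr 0 = s.arr 0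
  run : s'.arr 2 = s.arr 2
  bound : s'.reg 2 = s.reg 2
  output : s'.output = s.output ++ out

lemma Appends.trans {s s' s'' : State} {out out' : List ℕ} (h : Appends s s' out)
    (h' : Appends s' s'' out') : Appends s s'' (out ++ out') :=
  ⟨h'.input.trans h.input, h'.run.trans h.run, h'.bound.trans h.bound, by
    rw [h'.output, h.output, List.append_assoc]⟩

lemma State.Same.output_eq {s s' : State} (h : s.Same s') : s.output = s'.output := by
  rw [State.output, State.output, h.1, h.2 1 (by omega)]

lemma State.Same.appends {s s' : State} (h : s'.Same s) : Appends s s' [] :=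
  ⟨by rw [h.1], by rw [h.1], h.2 2 (by omega), by rw [h.output_eq, List.append_nil]⟩

lemma Appends.setReg_three {s s' : State} {out : List ℕ} (h : Appends s s' out) (v : ℕ) :
    Appends s (s'.setReg 3 v) out :=
  ⟨h.input, h.run, by simpa using h.bound, by
    rw [← h.output]
    simp [State.output]⟩

lemma runs_push (e : LExp) (s : State) :
    Runs (push e) s ((e.time + 15).eval (s.reg 2)) fun s' =>
      Appends s s' [s.val e] ∧ s'.reg 3 = s.reg 3 := by
  refine ((runs_setCell 1 (.var 1) e s).seq (b' := 10) fun s₁ h₁ =>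
    (runs_setVar 1 (.add (.var 1) (.const 1)) s₁).weaken ?_ fun s₂ h₂ => ?_).weaken ?_ fun _ h => h
  · simp [LExp.time]
  · have hval : s.val (.var 1) = s.reg 1 := rfl
    have hval' : s₁.val (.add (.var 1) (.const 1)) = s.reg 1 + 1 := by
      rw [h₁.val_eq]; rfl
    rw [hval] at h₁
    rw [hval'] at h₂
    have h := h₂.trans (h₁.setReg _ _)
    refine ⟨⟨?_, ?_, ?_, ?_⟩, ?_⟩
    · rw [h.1]; simp
    · rw [h.1]; simp
    · rw [h.2 2 (by omega)]; simp
    · rw [h.output_eq, State.output]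
      simp only [State.setReg_reg, Function.update_self, State.setReg_arr, State.setArr_arr,
        List.range_succ, List.map_append, List.map_singleton]
      congr 1
      refine List.map_congr_left fun i hi => ?_
      rw [Function.update_of_ne (List.mem_range.1 hi).ne]
    · rw [h.2 3 (by omega)]; simp
  · simp [LExp.time]
    omega

lemma eval_mono (T : Polynomial ℕ) : Monotone fun n => T.eval n := by
  intro m n h
  simp only [Polynomial.eval_eq_sum_range]
  gcongr

open Polynomial in
/-- A running time that is polynomial in a number `l` and in a polynomial expression of `l`, where `l`
is bounded linearly in `n`, is polynomially bounded in `n`. -/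
lemma exists_polynomial_le (T₁ T₂ : ℕ[X]) (a c d : ℕ) : ∃ T : ℕ[X], ∀ n l, l ≤ c + a * n →
    T₁.eval l + T₂.eval ((l ^ d + 1) + (l ^ d + 1)) ≤ T.eval n := by
  refine ⟨T₁.comp (C c + C a * X) +
    T₂.comp (((C c + C a * X) ^ d + 1) + ((C c + C a * X) ^ d + 1)), fun n l hl => ?_⟩
  simp only [eval_add, eval_comp, eval_C, eval_mul, eval_X, eval_pow, eval_one]
  refine add_le_add (eval_mono T₁ hl) (eval_mono T₂ ?_)
  gcongr

end RAM

/-! ### The program -/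

namespace ADP.CQ

open RAM LExp Covering

variable (Q : CQ)

/-- The tuple at position `reg 3` of relation `r` exists and is picked. -/
noncomputable def pickedExp (r : Fin Q.p) : LExp :=
  .and (lt (.var 3) (lengthExp Q r))
    (.sum 7 (eq (.arr 2 (.var 7)) (.add (numberExp Q r (.var 3)) (.const 1))))

/-- Append the values of the tuple at position `reg 3` of relation `r` to the output. -/
noncomputable def writeTuple (r : Fin Q.p) : Program :=
  seqAll ((List.finRange (Q.attrs r).card).map fun q : Fin _ => push (valueExp Q r (.var 3) q))

/-- The running time of `writeTuple`. -/
noncomputable def writeTupleTime (r : Fin Q.p) : Polynomial ℕ :=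
  seqTime ((List.finRange (Q.attrs r).card).map fun q : Fin _ => (valueExp Q r (.var 3) q).time + 15)

/-- The number of picked tuples of relation `r`. -/
noncomputable def countPickedExp (r : Fin Q.p) : LExp :=
  .sum 3 (.ite (pickedExp Q r) (.const 1) (.const 0))

/-- Append the part of the encoding of the solution that belongs to relation `r` to the output. -/
noncomputable def writeRel (r : Fin Q.p) : Program :=
  .seq (push (countPickedExp Q r)) (forLoop 3 (when (pickedExp Q r) (writeTuple Q r)))

open Polynomial in
/-- The running time of `writeRel`. -/
noncomputable def writeRelTime (r : Fin Q.p) : Polynomial ℕ :=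
  (countPickedExp Q r).time + 15 +
    (X * ((pickedExp Q r).time + (writeTupleTime Q r + 3) + 8) + 6)

variable {Q} {L : (i : Fin Q.p) → List (Tuple (Q.attrs i))} {k B : ℕ}

lemma holds_pickedExp {A : ℕ → ℕ → ℕ} {ρ : ℕ → ℕ} (hA : HasInput Q L k A) (r : Fin Q.p) :
    Holds B A (pickedExp Q r) ρ ↔
      ρ 3 < (L r).length ∧ ρ 3 * Q.p + r ∈ picked (A 2) B := by
  simp [pickedExp, eval_lengthExp hA, mem_picked, numberExp]

lemma HasInput.of_eq {A A' : ℕ → ℕ → ℕ} (hA : HasInput Q L k A) (h : A' 0 = A 0) :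
    HasInput Q L k A' := fun i => by rw [h, hA]

lemma runs_writeTuple {s : State} (hA : HasInput Q L k s.arr) (r : Fin Q.p)
    (hj : s.reg 3 < (L r).length) :
    Runs (writeTuple Q r) s ((writeTupleTime Q r).eval (s.reg 2)) fun s' =>
      Appends s s' (encodeTuple (tup Q L r (s.reg 3))) ∧ s'.reg 3 = s.reg 3 := by
  refine (Runs.seqAll (c := fun q : Fin _ => push (valueExp Q r (.var 3) q))
    (b := fun q : Fin _ => (valueExp Q r (.var 3) q).time + 15) (B := s.reg 2)
    (fun l s' => Appends s s' (l.map fun q =>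
      tup Q L r (s.reg 3) ((Q.attrs r).orderIsoOfFin rfl q)) ∧ s'.reg 3 = s.reg 3)
    (List.finRange (Q.attrs r).card) ?_ ?_).weaken le_rfl ?_
  · rintro q - l s₁ ⟨h₁, h₃⟩
    rw [← h₁.bound]
    refine (runs_push _ s₁).weaken le_rfl ?_
    rintro s₂ ⟨h₂, h₃'⟩
    refine ⟨?_, h₃'.trans h₃⟩
    rw [List.map_append, List.map_singleton]
    have hval : s₁.val (valueExp Q r (.var 3) q) =
        tup Q L r (s.reg 3) ((Q.attrs r).orderIsoOfFin rfl q) := by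
      have h3 : s₁.env 3 = s.reg 3 := h₃
      rw [State.val_def, eval_valueExp (hA.of_eq h₁.input) r (by simpa [h3] using hj), eval_var, h3]
    rw [← hval]
    exact h₁.trans h₂
  · exact ⟨State.Same.appends ⟨rfl, fun _ _ => rfl⟩, rfl⟩
  · rintro s' ⟨h, h'⟩
    refine ⟨?_, h'⟩
    rwa [encodeTuple, List.ofFn_eq_map]

lemma runs_writePicked {s : State} (hA : HasInput Q L k s.arr) (r : Fin Q.p)
    (hB : (L r).length ≤ s.reg 2) :
    Runs (forLoop 3 (when (pickedExp Q r) (writeTuple Q r))) s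
      (s.reg 2 * ((pickedExp Q r).time.eval (s.reg 2) +
        ((writeTupleTime Q r).eval (s.reg 2) + 3) + 8) + 6) fun s' =>
      Appends s s' ((select Q L (picked (s.arr 2) (s.reg 2)) r).flatMap encodeTuple) := by
  obtain ⟨G, hG⟩ : ∃ G, G = picked (s.arr 2) (s.reg 2) := ⟨_, rfl⟩
  rw [← hG]
  -- the tuples that are written when the loop has reached position `i`
  obtain ⟨out, hout⟩ : ∃ out : ℕ → List ℕ, ∀ i, out i =
      ((List.range (min i (L r).length)).filter fun j => j * Q.p + r ∈ G).flatMap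
        fun j => encodeTuple (tup Q L r j) := ⟨_, fun _ => rfl⟩
  refine (Runs.forLoop (by omega) rfl (fun i s' => Appends s s' (out i)) ?_ ?_).weaken
    le_rfl ?_
  · have : out 0 = [] := by simp [hout]
    rw [this]
    exact (State.Same.appends ⟨rfl, fun _ _ => rfl⟩).setReg_three 0
  · intro i hi s₁ h₁ h3 h2
    have henv : s₁.env 3 = i := h3
    have hcond : s₁.val (pickedExp Q r) ≠ 0 ↔ i < (L r).length ∧ i * Q.p + r ∈ G := by
      have := holds_pickedExp (B := s₁.reg 2) (ρ := s₁.env) (hA.of_eq h₁.input) r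
      rwa [henv, h₁.run, h₁.bound, ← hG, ← h₁.bound] at this
    rw [← h2]
    refine runs_when (fun h s₂ h₂ => ?_) fun h s₂ h₂ => ?_
    · obtain ⟨hi', hG'⟩ := hcond.1 h
      have h3' : s₂.reg 3 = i := (h₂.2 3 (by omega)).trans h3
      have h2' : s₂.reg 2 = s₁.reg 2 := h₂.2 2 (by omega)
      have happ := h₁.trans h₂.appends
      rw [← h2']
      refine (runs_writeTuple (hA.of_eq happ.input) r (by rwa [h3'])).weaken le_rfl ?_
      rintro s₃ ⟨h₃, h₃'⟩
      refine ⟨h₃'.trans h3', h₃.bound, ?_⟩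
      have hsucc : out (i + 1) = out i ++ [] ++ encodeTuple (tup Q L r (s₂.reg 3)) := by
        rw [hout, hout, min_eq_left (by omega), min_eq_left (by omega), List.range_succ]
        simp [List.filter_append, hG', h3']
      rw [hsucc]
      exact (happ.trans h₃).setReg_three _
    · have hcond' : ¬ (i < (L r).length ∧ i * Q.p + r ∈ G) := fun h' => hcond.2 h' h
      refine ⟨(h₂.2 3 (by omega)).trans h3, h₂.2 2 (by omega), ?_⟩
      have hsucc : out (i + 1) = out i ++ [] := by
        rw [hout, hout, List.append_nil]
        rcases lt_or_ge i (L r).length with hi' | hi'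
        · rw [min_eq_left (by omega), min_eq_left (by omega), List.range_succ]
          have : i * Q.p + r ∉ G := fun h' => hcond' ⟨hi', h'⟩
          simp [List.filter_append, this]
        · rw [min_eq_right (by omega), min_eq_right (by omega)]
      rw [hsucc]
      exact (h₁.trans h₂.appends).setReg_three _
  · intro s' h
    rwa [hout, min_eq_right hB, ← List.flatMap_map] at h

lemma eval_countPickedExp {s : State} (hA : HasInput Q L k s.arr) (r : Fin Q.p)
    (hB : (L r).length ≤ s.reg 2) :
    s.val (countPickedExp Q r) = (select Q L (picked (s.arr 2) (s.reg 2)) r).length := by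
  rw [State.val_def, countPickedExp, eval_sum, select, List.length_map]
  simp only [eval_ite, eval_const, holds_pickedExp hA, Function.update_self]
  rw [← Finset.card_filter, ← List.toFinset_card_of_nodup (List.nodup_range.filter _)]
  congr 1
  ext j
  simp only [Finset.mem_filter, Finset.mem_range, List.mem_toFinset, List.mem_filter,
    List.mem_range, decide_eq_true_eq]
  exact ⟨fun h => h.2, fun h => ⟨h.1.trans_le hB, h⟩⟩

lemma runs_writeRel {s : State} (hA : HasInput Q L k s.arr) (r : Fin Q.p)
    (hB : (L r).length ≤ s.reg 2) :
    Runs (writeRel Q r) s ((writeRelTime Q r).eval (s.reg 2)) fun s' =>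
      Appends s s' (relCode Q (select Q L (picked (s.arr 2) (s.reg 2))) r) := by
  have h := (runs_push (countPickedExp Q r) s).seq fun s₁ h₁ => by
    have h := runs_writePicked (hA.of_eq h₁.1.input) r (hB.trans_eq h₁.1.bound.symm)
    rw [h₁.1.bound, h₁.1.run] at h
    exact h.weaken le_rfl fun s₂ h₂ => h₁.1.trans h₂
  refine h.weaken (by simp [writeRelTime]) fun s' h' => ?_
  rwa [eval_countPickedExp hA r hB] at h'

variable (Q) in
/-- Compute the run of the covering algorithm with the rule `good`, with register `2` as the number of
its steps. -/
noncomputable def computeRun (good : LExp) : Program :=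
  forLoop 3 (setCell 2 (.var 3) (pickExp Q good))

/-- The entry `v` at time `t` is the one that the rule `φ` prescribes; see `IsRun`. -/
def IsEntry (Q : CQ) (L : (i : Fin Q.p) → List (Tuple (Q.attrs i))) (k B : ℕ)
    (φ : (ℕ → ℕ) → ℕ → ℕ → Prop) (P : ℕ → ℕ) (t v : ℕ) : Prop :=
  (∀ g, v = g + 1 → covered (positions Q L) (Uses Q) P t < k ∧ g < B ∧ φ P t g) ∧
    (v = 0 → covered (positions Q L) (Uses Q) P t < k → ∀ g < B, ¬ φ P t g)

lemma IsEntry.congr {φ : (ℕ → ℕ) → ℕ → ℕ → Prop} {P P' : ℕ → ℕ} {t v : ℕ}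
    (hφ : ∀ P P' t, (∀ t' < t, P t' = P' t') → ∀ g, φ P t g ↔ φ P' t g)
    (h : ∀ t' < t, P t' = P' t') (he : IsEntry Q L k B φ P t v) : IsEntry Q L k B φ P' t v := by
  simpa only [IsEntry, covered_congr h, hφ P P' t h] using he

lemma runs_computeRun {good : LExp} {N : ℕ} {φ : (ℕ → ℕ) → ℕ → ℕ → Prop}
    (hφ : ∀ P P' t, (∀ t' < t, P t' = P' t') → ∀ g, φ P t g ↔ φ P' t g)
    (hgood : ∀ A ρ, HasInput Q L k A → ρ 3 ≤ B → ρ 4 = N →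
      (Holds B A good ρ ↔ φ (A 2) (ρ 3) (ρ 5)))
    (hB : ∀ r, (L r).length ≤ B) {s : State} (hA : HasInput Q L k s.arr) (h2 : s.reg 2 = B)
    (h4 : s.reg 4 = N) :
    Runs (computeRun Q good) s (B * ((pickExp Q good).time.eval B + 13) + 6) fun s' =>
      s'.arr 0 = s.arr 0 ∧ s'.reg 2 = B ∧ s'.reg 1 = s.reg 1 ∧
        IsRun (positions Q L) (Uses Q) (s'.arr 2) k B (φ (s'.arr 2)) := by
  refine (Runs.forLoop (by omega) h2 (fun i s' => s'.arr 0 = s.arr 0 ∧ s'.reg 1 = s.reg 1 ∧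
    s'.reg 2 = B ∧ s'.reg 4 = N ∧
      ∀ t < i, IsEntry Q L k B φ (s'.arr 2) t (s'.arr 2 t)) (b := (pickExp Q good).time.eval B + 5)
      ?_ ?_).weaken le_rfl ?_
  · exact ⟨rfl, by simp, by simpa using h2, by simpa using h4, by simp⟩
  · rintro i hi s₁ ⟨ha, h1, -, h4, hE⟩ h3 h2
    refine (runs_setCell 2 (.var 3) (pickExp Q good) s₁).weaken ?_ fun s₂ h₂ => ?_
    · rw [h2]
      simp [LExp.time]
      omega
    have hA₁ := hA.of_eq ha
    have h3' : s₁.env 3 = i := h3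
    have hvi : s₁.val (.var 3) = i := h3
    obtain ⟨v, hv⟩ : ∃ v, v = s₁.val (pickExp Q good) := ⟨_, rfl⟩
    have hpick : IsEntry Q L k B φ (s₁.arr 2) i v := by
      have := eval_pickExp (φ := φ (s₁.arr 2) i) (v := v) (good := good) (B := B) (ρ := s₁.env)
        hA₁ hB (by rw [h3']; omega) (fun ρ' hρ' => ?_) (by rw [hv, State.val_def, h2])
      · rwa [h3'] at this
      · have e3 : ρ' 3 = i := (hρ' 3 (by omega)).trans h3'
        rw [hgood s₁.arr ρ' hA₁ (by omega) ((hρ' 4 (by omega)).trans h4), e3]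
    rw [hvi, ← hv] at h₂
    have harr2 : s₂.arr 2 = Function.update (s₁.arr 2) i v := by rw [h₂.1]; simp
    have hreg : ∀ y < 5, s₂.reg y = s₁.reg y := fun y hy => h₂.2 y hy
    refine ⟨by rw [hreg 3 (by omega), h3], by rw [hreg 2 (by omega), h2], ?_, ?_, ?_, ?_, ?_⟩
    · rw [State.setReg_arr, h₂.1, ← ha]
      simp
    · simpa [hreg 1] using h1
    · simpa [hreg 2] using h2
    · simpa [hreg 4] using h4
    · intro t ht
      rw [State.setReg_arr, harr2]
      have hagree : ∀ t' < t, s₁.arr 2 t' = Function.update (s₁.arr 2) i v t' := fun t' ht' => by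
        rw [Function.update_of_ne (by omega)]
      rcases Nat.lt_succ_iff_lt_or_eq.1 ht with h | rfl
      · rw [Function.update_of_ne h.ne]
        exact (hE t h).congr hφ hagree
      · rw [Function.update_self]
        exact hpick.congr hφ hagree
  · rintro s' ⟨ha, h1, h2, -, hE⟩
    exact ⟨ha, h2, h1, fun t ht g hg => (hE t ht).1 g hg, fun t ht h0 => (hE t ht).2 h0⟩

variable (Q) in
/-- The approximation algorithm with the rule `good`. The scaling factor `reg 4` exceeds the product
of the number of all input tuples and the squared number of all results, and the number `reg 2` of
steps suffices for the covering algorithm. -/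
noncomputable def program (good : LExp) : Program :=
  .seq (setVar 2 (.var 0)) <|
  .seq (setVar 4 (.add (pow (2 * Q.p + 1)) (.const 1))) <|
  .seq (setVar 2 (.add (.var 4) (.var 4))) <|
  .seq (computeRun Q good) (seqAll ((List.finRange Q.p).map (writeRel Q)))

/-- The scaling factor for an input with `n` numbers. -/
def scaling (Q : CQ) (n : ℕ) : ℕ := n ^ (2 * Q.p + 1) + 1

lemma runs_program {good : LExp} {φ : (ℕ → ℕ) → ℕ → ℕ → Prop} {n N : ℕ}
    (hn : n = (Q.encode L).length + 1) (hN : N = scaling Q n) (hNB : B = N + N)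
    (hφ : ∀ P P' t, (∀ t' < t, P t' = P' t') → ∀ g, φ P t g ↔ φ P' t g)
    (hgood : ∀ A ρ, HasInput Q L k A → ρ 3 ≤ B → ρ 4 = N →
      (Holds B A good ρ ↔ φ (A 2) (ρ 3) (ρ 5)))
    (hB : ∀ r, (L r).length ≤ B) :
    Runs (program Q good) (State.init (k :: Q.encode L))
      (4 + ((pow (2 * Q.p + 1)).time.eval n + 8 + (10 + (B * ((pickExp Q good).time.eval B + 13) +
        6 + (seqTime ((List.finRange Q.p).map (writeRelTime Q))).eval B))))
      fun s => ∃ P, IsRun (positions Q L) (Uses Q) P k B (φ P) ∧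
        s.output = Q.encode (select Q L (picked P B)) := by
  refine Runs.seq (P := fun s => s.Same ((State.init (k :: Q.encode L)).setReg 2 n))
    ((runs_setVar 2 (.var 0) _).weaken (by simp [LExp.time]) fun s h => ?_) ?_
  · have : (State.init (k :: Q.encode L)).val (.var 0) = n := by
      rw [State.val_def, eval_var, hn]
      rfl
    rwa [this] at h
  intro s₁ h₁
  have h2₁ : s₁.reg 2 = n := by rw [h₁.2 2 (by omega)]; simp
  refine Runs.seq (P := fun s => s.Same (s₁.setReg 4 N))
    ((runs_setVar 4 _ s₁).weaken (by simp [LExp.time, h2₁]) fun s h => ?_) ?_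
  · have : s₁.val (.add (pow (2 * Q.p + 1)) (.const 1)) = N := by
      rw [State.val_def, eval_add, eval_pow, h2₁, hN]
      rfl
    rwa [this] at h
  intro s₂ h₂
  have h4₂ : s₂.reg 4 = N := by rw [h₂.2 4 (by omega)]; simp
  refine Runs.seq (P := fun s => s.Same (s₂.setReg 2 B))
    ((runs_setVar 2 _ s₂).weaken (by simp [LExp.time]) fun s h => ?_) ?_
  · have : s₂.val (.add (.var 4) (.var 4)) = B := by
      rw [State.val_def, eval_add, eval_var, hNB]
      exact congrArg₂ _ h4₂ h4₂
    rwa [this] at h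
  intro s₃ h₃
  have h2 : s₃.reg 2 = B := by rw [h₃.2 2 (by omega)]; simp
  have h4 : s₃.reg 4 = N := by rw [h₃.2 4 (by omega)]; simpa using h4₂
  have h1 : s₃.reg 1 = 0 := by
    rw [h₃.2 1 (by omega), State.setReg_reg, Function.update_of_ne (by omega), h₂.2 1 (by omega),
      State.setReg_reg, Function.update_of_ne (by omega), h₁.2 1 (by omega)]
    rfl
  have hA : HasInput Q L k s₃.arr := by
    intro i
    rw [h₃.1, State.setReg_arr, h₂.1, State.setReg_arr, h₁.1]
    rfl
  refine (runs_computeRun hφ hgood hB hA h2 h4).seq ?_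
  rintro s₄ ⟨ha, h2', h1', hrun⟩
  have hA₄ := hA.of_eq ha
  refine (Runs.seqAll (fun l s => Appends s₄ s
    (l.flatMap (relCode Q (select Q L (picked (s₄.arr 2) B))))) _ ?_ ?_).weaken le_rfl ?_
  · intro r _ l s h
    have hs := h.bound.trans h2'
    have := runs_writeRel (hA₄.of_eq h.input) r (by rw [hs]; exact hB r)
    rw [hs, h.run] at this
    refine this.weaken le_rfl fun s' h' => ?_
    rw [List.flatMap_append, List.flatMap_singleton]
    exact h.trans h'
  · exact State.Same.appends ⟨rfl, fun _ _ => rfl⟩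
  · intro s h
    refine ⟨_, hrun, ?_⟩
    rw [h.output, State.output, h1', h1]
    rfl

/-! ### The approximation algorithms -/

/-- A rule for the next pick that a bounded sum expression decides, and that leads to few picks, gives
an approximation algorithm. -/
theorem isPolyTimeApprox_program (hQ : Q.IsFull) {good : LExp} {α : ℕ → ℝ}
    (φ : ((i : Fin Q.p) → List (Tuple (Q.attrs i))) → ℕ → ℕ → (ℕ → ℕ) → ℕ → ℕ → Prop)
    (hφ : ∀ L B N P P' t, (∀ t' < t, P t' = P' t') → ∀ g, φ L B N P t g ↔ φ L B N P' t g)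
    (hgood : ∀ L k B A ρ, HasInput Q L k A → (∀ r, (L r).length ≤ B) → ρ 3 ≤ B →
      (Holds B A good ρ ↔ φ L B (ρ 4) (A 2) (ρ 3) (ρ 5)))
    (hα : ∀ k, 1 ≤ k → 0 ≤ α k)
    (happrox : ∀ L k B N P, 1 ≤ k → k ≤ (positions Q L).card → N + (positions Q L).card < B →
      (∀ e ∈ positions Q L, ∀ g, Uses Q g e → g < B) →
      IsRun (positions Q L) (Uses Q) P k B (φ L B N P) →
      k ≤ covered (positions Q L) (Uses Q) P B ∧ ∀ S : Finset ℕ,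
        (positions Q L).card * (positions Q L).card * S.card < N →
        (∃ F ⊆ positions Q L, k ≤ F.card ∧ ∀ e ∈ F, ∃ g ∈ S, Uses Q g e) →
        (picks P B : ℝ) ≤ α k * S.card) :
    Q.IsPolyTimeApprox (program Q good) α := by
  classical
  obtain ⟨T, hT⟩ := exists_polynomial_le ((pow (2 * Q.p + 1)).time + 22)
    (.X * ((pickExp Q good).time + 13) + 6 + seqTime ((List.finRange Q.p).map (writeRelTime Q)))
    (∑ r, (Q.attrs r).card) (Q.p + 1) (2 * Q.p + 1)
  refine ⟨T, fun D L k hL hk hkD => ?_⟩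
  rw [ncard_result hQ hL] at hkD
  obtain ⟨l, hl⟩ : ∃ l, l = (Q.encode L).length + 1 := ⟨_, rfl⟩
  obtain ⟨N, hN⟩ : ∃ N, N = scaling Q l := ⟨_, rfl⟩
  obtain ⟨B, hNB⟩ : ∃ B, B = N + N := ⟨_, rfl⟩
  have hl1 : 1 ≤ l := by omega
  have hNl : l ^ (2 * Q.p + 1) < N := by rw [hN, scaling]; omega
  have hcard : (positions Q L).card ≤ l ^ Q.p :=
    card_positions_le fun r => (hL.length_le_length r).trans (by omega)
  have hlen : ∀ r, (L r).length ≤ l := fun r => (hL.length_le_length r).trans (by omega)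
  have hlN : l ≤ l ^ (2 * Q.p + 1) := Nat.le_self_pow (by omega) l
  obtain ⟨t, s, hexec, ht, P, hrun, hout⟩ := runs_program (B := B) (L := L) (k := k) hl hN hNB
    (hφ L B N) (fun A ρ hA h3 h4 => by
      rw [hgood L k B A ρ hA (fun r => (hlen r).trans (by omega)) h3, h4])
    (fun r => (hlen r).trans (by omega))
  have hcardN : (positions Q L).card < N := hcard.trans_lt
    ((Nat.pow_le_pow_right hl1 (by omega)).trans_lt hNl)
  have huses : ∀ e ∈ positions Q L, ∀ g, Uses Q g e → g < B := by
    rintro e he _ ⟨r, rfl⟩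
    have h₁ : e r + 1 ≤ l := ((mem_positions.1 he).1 r).trans_le (hlen r)
    have h₂ : Q.p ≤ l := p_le_length_encode.trans (by omega : (Q.encode L).length ≤ l)
    have h₃ : (e r + 1) * Q.p ≤ l * l := Nat.mul_le_mul h₁ h₂
    have h₄ : l * l ≤ l ^ (2 * Q.p + 1) := by
      rw [← pow_two]
      exact Nat.pow_le_pow_right hl1 (by have := Q.p_pos; omega)
    have := r.2
    rw [add_mul, one_mul] at h₃
    omega
  obtain ⟨hcov, happ⟩ := happrox L k B N P hk hkD (by omega) huses hrun
  have hpicked := card_picked_le (P := P) B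
  refine ⟨selected Q L (picked P B), select Q L (picked P B), t, isListing_selected hL _,
    ⟨s, hexec, hout⟩, ht.trans ?_, ?_, fun S' hS' => ?_⟩
  · refine le_trans (le_of_eq ?_) (hT D.size l (by have := hL.length_encode_le; omega))
    rw [show (l ^ (2 * Q.p + 1) + 1) + (l ^ (2 * Q.p + 1) + 1) = B by rw [hNB, hN, scaling]]
    simp only [Polynomial.eval_add, Polynomial.eval_mul, Polynomial.eval_X,
      Polynomial.eval_ofNat]
    ring
  · refine isSolution_selected hQ hL (Finset.filter_subset _ _) hcov fun e he => ?_
    exact not_active_iff.1 (Finset.mem_filter.1 he).2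
  · obtain ⟨G, hG, hF⟩ := hS'.exists_finset hQ hL
    have hGl : G.card ≤ l := by
      have h₁ : S'.size ≤ D.size := Finset.sum_le_sum fun r _ => Finset.card_le_card (hS'.1 r)
      have := hL.size_le
      omega
    have hGN : (positions Q L).card * (positions Q L).card * G.card < N := by
      refine lt_of_le_of_lt ?_ hNl
      calc (positions Q L).card * (positions Q L).card * G.card ≤ l ^ Q.p * l ^ Q.p * l := by
            gcongr
        _ = l ^ (2 * Q.p + 1) := by ring
    calc ((selected Q L (picked P B)).size : ℝ) ≤ picks P B := by
          exact_mod_cast (size_selected_le _).trans hpicked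
      _ ≤ α k * G.card := happ G hGN hF
      _ ≤ α k * S'.size := by
          have := hα k hk
          gcongr

end ADP.CQ

theorem theorem6p1 :
    (∃ C : ℝ, ∀ Q : ADP.CQ, Q.IsFull →
      ∃ c : RAM.Program, Q.IsPolyTimeApprox c (fun k => C * (1 + Real.log (k : ℝ)))) ∧
    (∀ Q : ADP.CQ, Q.IsFull →
      ∃ c : RAM.Program, Q.IsPolyTimeApprox c (fun _ => (Q.p : ℝ))) := by
  open ADP.CQ Covering in
  refine ⟨⟨1, fun Q hQ => ⟨program Q (greedyExp Q), ?_⟩⟩, fun Q hQ =>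
    ⟨program Q (tightExp Q), ?_⟩⟩
  · refine isPolyTimeApprox_program hQ
      (fun L B _ P => Greedy (positions Q L) (Uses Q) P B) (fun L B N P P' t h g => greedy_congr h)
      (fun L k B A ρ hA hB h3 => holds_greedyExp hA hB h3) (fun k hk => ?_) ?_
    · have := Real.log_nonneg (by exact_mod_cast hk : (1 : ℝ) ≤ k)
      linarith
    · intro L k B N P hk hkE hB hlt hrun
      have hex : ∀ e ∈ positions Q L, ∃ g, Uses Q g e := fun e _ => exists_uses e
      refine ⟨Greedy.covers hrun hlt hex hkE (by omega), fun S _ hS => ?_⟩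
      rw [one_mul]
      exact Greedy.picks_le hrun hlt hex hkE hk (by omega) hS
  · refine isPolyTimeApprox_program hQ
      (fun L _ N P => Tight (positions Q L) (Uses Q) P N) (fun L B N P P' t h g => tight_congr h)
      (fun L k B A ρ hA hB h3 => holds_tightExp hA hB h3) (fun _ _ => by positivity) ?_
    intro L k B N P hk hkE hB hlt hrun
    have hex : ∀ e ∈ positions Q L, ∃ g, Uses Q g e := fun e _ => exists_uses e
    refine ⟨Tight.covers hrun hlt hkE hex hB, fun S hN hS => ?_⟩
    exact_mod_cast Tight.picks_le hrun hlt hkE Q.p_pos (fun e _ => exists_finset_uses e) hex hk hB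
      hN hS
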